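/- **Setting.** Let $d\ge 1$, let $f:\mathbb{R}^d\to\mathbb{R}$ be twice differentiable and bounded below, let $\theta^*$ be a local minimum of $f$, and suppose the Hessian of $f$ is $H$-Lipschitz: $\|\nabla^2 f(\theta_1)-\nabla^2 f(\theta_2)\|_{\mathrm{op}}\le H\|\theta_1-\theta_2\|_2$ for all $\theta_1,\theta_2$. Let $\rho$ be a probability distribution on $\mathbb{R}^d$ with $\mathbb{E}_{\theta\sim\rho}[\theta]=0$ and $\mathbb{E}_{\theta\sim\rho}[\theta\theta^{\mathsf T}]=c^2 I$, where $c>0$ and $c\ge\|\theta^*\|_2$, and with $M_p:=\mathbb{E}_{\theta\sim\rho}[\|\theta-\theta^*\|_2^p]$ finite for $p=4$. Let $f$ be coordinate-wise smooth with constants $L_1,\dots,L_d>0$, i.e. $$\left|f(\theta_1)-f(\theta_2)-\langle\nabla f(\theta_2),\theta_1-\theta_2\rangle\right|\le \tfrac12\sum_{i=1}^d L_i\,(\theta_1(i)-\theta_2(i))^2\quad\text{for all }\theta_1,\theta_2,$$ and put $L_f:=\sum_i L_i$. Let $\mathrm{EGOP}(f):=\mathbb{E}_{\theta\sim\rho}[\nabla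 f(\theta)\nabla f(\theta)^{\mathsf T}]=V\,\mathrm{diag}(\lambda_1,\dots,\lambda_d)\,V^{\mathsf T}$ with $V$ orthogonal and $\lambda_1\ge\dots\ge\lambda_d$, let $v_1$ be the first column of $V$, and put $$\beta:=\|v_1\|_1^2/d,\qquad \mathrm{sr}_f:=\frac{\sum_{i=1}^d\sqrt{\lambda_i}}{\sqrt{\lambda_1}},\qquad \tilde f(\tilde\theta):=f(V\tilde\theta).$$ Let $\theta_0\in\mathbb{R}^d$ and $\Delta_f:=f(\theta_0)-\inf_\theta f(\theta)$. Full-batch Adagrad with step size $\eta>0$ and denominator offset $\tau>0$, applied to a function $g$ from the starting point $x_1$, is the iteration $$x_{t+1}(i)=x_t(i)-\eta\,\frac{\nabla g(x_t)(i)}{\sqrt{\sum_{s=1}^{t}\nabla g(x_s)(i)^2}+\tau},\qquad i=1,\dots,d,\ t\ge 1.$$ Let $T\ge1$. Let $\tilde\theta_1=V^{\mathsf T}\theta_0,\tilde\theta_2,\dots,\tilde\theta_T$ be its iterates on $\tilde f$ from $V^{\mathsf T}\theta_0$, and $\theta_1=\theta_0,\theta_2,\dots,\theta_T$ (the point $\theta_1$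 being the initial point) its iterates on $f$ from $\theta_0$. **Theorem.** There are an absolute constant $C>0$ and a fixed real polynomial $p$ in six variables such that in every such setting the following holds. Let $\delta,\varepsilon\in(0,1)$, put $\zeta:=\delta/(1+\delta)$, and suppose $$\zeta\le\frac{\beta\varepsilon\sqrt{1-\varepsilon^2}}{\beta\varepsilon\sqrt{1-\varepsilon^2}+4-\varepsilon^2}\qquad\text{and}\qquad H\le\min(T_1,T_2),$$ where $$T_1=\frac{\varepsilon\,\lambda_{\max}(\nabla^2 f(\theta^*))\,(\beta-\delta)}{2\left(\max_{1\le t\le T}\|\tilde\theta_t\|_2+c\right)(1+\delta)},\qquad T_2=\frac{\lambda_{\max}(\nabla^2 f(\theta^*))}{M_4\sqrt d}\left(\sqrt{M_3^2+\zeta c^2M_4}-M_3\right).$$ Then, with $\ell:=\log p\left(T,d,L_f,\eta,1/\tau,\|\nabla f(\theta_0)\|_\infty\right)$, $$\frac1T\sum_{t=1}^T\|\nabla\tilde f(\tilde\theta_t)\|_1\le C\left(\frac{\eta}{\sqrt T}\left(\frac{1}{\beta-\delta}\cdot\frac{\mathrm{sr}_f}{d}+\varepsilon\right)L_f\,\ell+\frac{\Delta_f}{\eta\sqrt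 T}+\frac{d\,\tau}{\sqrt T}\right),$$ whereas for Adagrad in the original coordinates $$\frac1T\sum_{t=1}^T\|\nabla f(\theta_t)\|_1\le C\left(\frac{\eta}{\sqrt T}\,L_f\,\ell+\frac{\Delta_f}{\eta\sqrt T}+\frac{d\,\tau}{\sqrt T}\right).$$ Thus in the first bound $L_f$ is multiplied by $\frac{1}{\beta-\delta}\cdot\frac{\mathrm{sr}_f}{d}+\varepsilon$. (In the degenerate case $\lambda_1=0$ the value of $\mathrm{sr}_f$ is read as $0$.) -/

import Mathlib

open MeasureTheory

noncomputable section

namespace EGOP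

/-- Parameter space `ℝ^d` with the Euclidean norm. -/
abbrev Vec (d : ℕ) : Type := EuclideanSpace ℝ (Fin d)

variable {d : ℕ}

/-- The linear map `x ↦ V x` on `ℝ^d` given by a square matrix. -/
def apply (V : Matrix (Fin d) (Fin d) ℝ) (x : Vec d) : Vec d :=
  WithLp.toLp 2 (V.mulVec x.ofLp)

/-- The `ℓ¹` norm of a vector. -/
def l1norm (x : Vec d) : ℝ := ∑ i, |x i|

/-- The `ℓ^∞` norm of a vector: the norm of `Fin d → ℝ` is the maximum norm. -/
def linftyNorm (x : Vec d) : ℝ := ‖x.ofLp‖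

/-- The Hessian of `f` at `θ`, as the derivative of the gradient map. The norm of
`Vec d →L[ℝ] Vec d` is the spectral norm. -/
def hessian (f : Vec d → ℝ) (θ : Vec d) : Vec d →L[ℝ] Vec d := fderiv ℝ (gradient f) θ

/-- `f` is twice differentiable on the whole space. -/
def TwiceDifferentiable (f : Vec d → ℝ) : Prop :=
  Differentiable ℝ f ∧ Differentiable ℝ (gradient f)

/-- The Hessian of `f` is `H`-Lipschitz in the spectral norm. -/
def HessianLipschitz (f : Vec d → ℝ) (H : ℝ) : Prop :=
  ∀ θ₁ θ₂ : Vec d, ‖hessian f θ₁ - hessian f θ₂‖ ≤ H * ‖θ₁ - θ₂‖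

/-- The largest eigenvalue of an operator (used for symmetric operators only). -/
def lambdaMax (A : Vec d →L[ℝ] Vec d) : ℝ :=
  sSup {μ : ℝ | Module.End.HasEigenvalue (A : Vec d →ₗ[ℝ] Vec d) μ}

/-- `f` satisfies coordinate-wise smoothness with constants `L₁, …, L_d > 0`. -/
def CoordSmooth (f : Vec d → ℝ) (L : Fin d → ℝ) : Prop :=
  (∀ i, 0 < L i) ∧
  ∀ θ₁ θ₂ : Vec d,
    |f θ₁ - f θ₂ - inner ℝ (gradient f θ₂) (θ₁ - θ₂)| ≤
      (1 / 2) * ∑ i, L i * (θ₁ i - θ₂ i) ^ 2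

/-- The distribution `ρ` is mean-zero and isotropic: `E θ = 0` and `E[θ θᵀ] = c² I`. -/
structure MeanZeroIsotropic (ρ : Measure (Vec d)) (c : ℝ) : Prop where
  mean_zero : ∀ i, ∫ θ, θ i ∂ρ = 0
  second_moment : ∀ i j, ∫ θ, θ i * θ j ∂ρ = if i = j then c ^ 2 else 0

/-- The expected gradient outer product `E_{θ∼ρ}[∇f(θ) ∇f(θ)ᵀ]`. -/
def egop (ρ : Measure (Vec d)) (f : Vec d → ℝ) : Matrix (Fin d) (Fin d) ℝ :=
  Matrix.of fun i j => ∫ θ, gradient f θ i * gradient f θ j ∂ρ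

/-- `P = V diag(lam) Vᵀ` with `V` orthogonal and the eigenvalues in decreasing order;
the `k`-th column of `V` is the eigenvector for `lam k`. -/
structure IsEigendecomposition (P V : Matrix (Fin d) (Fin d) ℝ) (lam : Fin d → ℝ) : Prop where
  orthogonal : V ∈ Matrix.orthogonalGroup (Fin d) ℝ
  antitone : Antitone lam
  eq : P = V * Matrix.diagonal lam * V.transpose

/-- `M_p = E_{θ∼ρ} ‖θ - θ*‖₂^p`. -/
def centralMoment (ρ : Measure (Vec d)) (θstar : Vec d) (p : ℕ) : ℝ :=
  ∫ θ, ‖θ - θstar‖ ^ p ∂ρ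

/-- The stable rank `∑ᵢ √λᵢ / √λ_max` of eigenvalues in decreasing order. -/
def stableRank [NeZero d] (lam : Fin d → ℝ) : ℝ :=
  (∑ i, √(lam i)) / √(lam 0)

/-- The density `‖v₁‖₁² / d` of the leading eigenvector, the first column of `V`. -/
def density [NeZero d] (V : Matrix (Fin d) (Fin d) ℝ) : ℝ :=
  (∑ i, |V i 0|) ^ 2 / d

/-- State of full-batch diagonal Adagrad after `n` updates: the current point and the
accumulated squared gradient entries. With gradient `g` at the current point, one update adds
`g(i)²` to the accumulator `s(i)` and then moves coordinate `i` by `-η g(i) / (√s(i) + τ)`. -/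
def adagradState (η τ : ℝ) (f : Vec d → ℝ) (x₀ : Vec d) : ℕ → Vec d × (Fin d → ℝ)
  | 0 => (x₀, 0)
  | n + 1 =>
    let x := (adagradState η τ f x₀ n).1
    let s : Fin d → ℝ := fun i => (adagradState η τ f x₀ n).2 i + gradient f x i ^ 2
    (WithLp.toLp 2 fun i => x i - η * gradient f x i / (√(s i) + τ), s)

/-- The Adagrad point after `n` updates from `x₀`. -/
def adagrad (η τ : ℝ) (f : Vec d → ℝ) (x₀ : Vec d) (n : ℕ) : Vec d :=
  (adagradState η τ f x₀ n).1

/-- The average `ℓ¹` gradient norm over the `T` Adagrad iterates `x₀ = θ₁, …, θ_T`. -/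
def adagradAverage (η τ : ℝ) (f : Vec d → ℝ) (x₀ : Vec d) (T : ℕ) : ℝ :=
  (1 / (T : ℝ)) * ∑ t ∈ Finset.range T, l1norm (gradient f (adagrad η τ f x₀ t))

/-- The largest Euclidean norm among the `T` Adagrad iterates `x₀ = θ₁, …, θ_T`. -/
def adagradRadius (η τ : ℝ) (f : Vec d → ℝ) (x₀ : Vec d) (T : ℕ) : ℝ :=
  ⨆ t : Fin T, ‖adagrad η τ f x₀ t‖

/-- First threshold on the Lipschitz constant of the Hessian; `lamH` is the largest Hessian
eigenvalue at the local minimum and `B` the largest norm of an iterate. -/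
def threshold₁ (lamH c B β δ ε : ℝ) : ℝ :=
  ε * lamH * (β - δ) / (2 * (B + c) * (1 + δ))

/-- Second threshold on the Lipschitz constant of the Hessian, with `ζ = δ / (1 + δ)`. -/
def threshold₂ (d : ℕ) (lamH c M₃ M₄ δ : ℝ) : ℝ :=
  lamH / (M₄ * √(d : ℝ)) * (√(M₃ ^ 2 + δ / (1 + δ) * c ^ 2 * M₄) - M₃)

end EGOP

end

namespace EGOP

/-! ### Sums of normalised squares -/

/-! Adagrad adapts to any diagonal curvature bound. If every step satisfies a quadratic upper bound
with coordinate constants `M i`, telescoping it bounds the sums of `g² / (√acc + τ)` by the function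
decrease plus `∑ M i` times a logarithm. These sums in turn dominate `√(∑ g²) - τ`, and
Cauchy–Schwarz in time gives `sum_l1norm_adagrad_le`. In the original coordinates `M = L`, which is
the second bound.

In rotated coordinates the task is to find constants of small sum. Write `A` for the Hessian at the
local minimum, `μ` for its top eigenvalue, `P` for the EGOP. Near the minimum the gradient is close
to `A (θ - θ*)`, so isotropy makes the quadratic form of `P` comparable to `c² ‖A w‖²`, with errors
of order `H M₃` and `H² M₄` that the second threshold absorbs. Hence `A²` is at most `(2 / c²) P +
(ζ μ)²`, and monotonicity of the operator square root bounds `A` by an operator diagonal in the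
eigenbasis of `P`, with entries `2 √λₖ / c + ζ μ`.

The sum of these entries is governed by `sr_f · μ`, because `√λ₁` is at most a multiple of `c μ`,
plus `d ζ μ`. Density enters through the sign vector `s` of `v₁`: it gives `λ₁ β d ≤ sᵀ P s`, which
is about `c² ‖A s‖² ≤ c² μ ∑ L i`. As `λ₁` is at least about `c² μ²`, one gets `μ β d ≤ 8 L_f`. This
is `exists_diagonal_majorant`.

Away from the minimum the Hessian drifts by at most `H` times the distance, which the first
threshold turns into the `ε L_f` term. The radius there covers only the `T` averaged iterates,
whereas the descent argument also visits the next point; `adagradAverage_comp_apply_le` resolves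
this by comparing the step length with the radius. -/

lemma sqrt_sub_le_sum_sq_div (a : ℕ → ℝ) {τ : ℝ} (hτ : 0 < τ) (n : ℕ) :
    √(∑ k ∈ Finset.range n, a k ^ 2) - τ ≤
      ∑ k ∈ Finset.range n, a k ^ 2 / (√(∑ j ∈ Finset.range (k + 1), a j ^ 2) + τ) := by
  set S : ℝ := ∑ k ∈ Finset.range n, a k ^ 2 with hS
  have hS0 : 0 ≤ S := Finset.sum_nonneg fun _ _ => sq_nonneg _
  -- Every denominator is replaced by the last and largest one; then `S - τ² = (√S - τ)(√S + τ)`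
  -- finishes.
  have h1 : S / (√S + τ) ≤
      ∑ k ∈ Finset.range n, a k ^ 2 / (√(∑ j ∈ Finset.range (k + 1), a j ^ 2) + τ) := by
    rw [hS, Finset.sum_div]
    refine Finset.sum_le_sum fun k hk => ?_
    have hsub : ∑ j ∈ Finset.range (k + 1), a j ^ 2 ≤ S :=
      Finset.sum_le_sum_of_subset_of_nonneg
        (Finset.range_subset_range.2 (Finset.mem_range.1 hk)) fun _ _ _ => sq_nonneg _
    have := Real.sqrt_le_sqrt hsub
    gcongr
  refine le_trans ?_ h1
  rw [le_div_iff₀ (by positivity)]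
  nlinarith [Real.sq_sqrt hS0, sq_nonneg τ]

/-- Since `(√S + τ)² ≥ S + τ²`, each term is at most `1 - r`, where `r` is the ratio of consecutive
values of `1 + S / τ²`. The inequality `1 - r ≤ -log r` then telescopes. -/
lemma sum_sq_div_sq_le_log (a : ℕ → ℝ) {τ : ℝ} (hτ : 0 < τ) (n : ℕ) :
    ∑ k ∈ Finset.range n, a k ^ 2 / (√(∑ j ∈ Finset.range (k + 1), a j ^ 2) + τ) ^ 2 ≤
      Real.log (1 + (∑ k ∈ Finset.range n, a k ^ 2) / τ ^ 2) := by
  induction n with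
  | zero => simp
  | succ n ih =>
    rw [Finset.sum_range_succ]
    set S : ℝ := ∑ k ∈ Finset.range n, a k ^ 2 with hS
    have hS0 : 0 ≤ S := Finset.sum_nonneg fun _ _ => sq_nonneg _
    set S' : ℝ := ∑ k ∈ Finset.range (n + 1), a k ^ 2 with hS'
    have hSS : S' = S + a n ^ 2 := Finset.sum_range_succ _ _
    have hS'0 : 0 ≤ S' := by rw [hSS]; positivity
    have hle : a n ^ 2 / (√S' + τ) ^ 2 ≤ a n ^ 2 / (S' + τ ^ 2) := by
      have : S' + τ ^ 2 ≤ (√S' + τ) ^ 2 := by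
        nlinarith [Real.sq_sqrt hS'0, Real.sqrt_nonneg S', mul_nonneg (Real.sqrt_nonneg S') hτ.le]
      gcongr
    have h1 : (0 : ℝ) < 1 + S / τ ^ 2 := by positivity
    have h2 : (0 : ℝ) < 1 + S' / τ ^ 2 := by positivity
    have hlog := Real.log_le_sub_one_of_pos (div_pos h1 h2)
    rw [Real.log_div h1.ne' h2.ne'] at hlog
    have heq : (1 + S / τ ^ 2) / (1 + S' / τ ^ 2) - 1 = -(a n ^ 2 / (S' + τ ^ 2)) := by
      have : S' + τ ^ 2 ≠ 0 := by positivity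
      have : 1 + S' / τ ^ 2 ≠ 0 := h2.ne'
      rw [hSS] at *
      field_simp
      ring
    linarith

/-! ### Adagrad under a descent inequality -/

variable {d : ℕ} {η τ : ℝ} {g : Vec d → ℝ} {x₀ : Vec d}

lemma adagradState_snd (n : ℕ) (i : Fin d) :
    (adagradState η τ g x₀ n).2 i =
      ∑ k ∈ Finset.range n, gradient g (adagrad η τ g x₀ k) i ^ 2 := by
  induction n with
  | zero => simp [adagradState]
  | succ n ih =>
    rw [Finset.sum_range_succ, ← ih]
    rfl

lemma adagrad_zero : adagrad η τ g x₀ 0 = x₀ := rfl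

lemma adagrad_succ_sub (n : ℕ) (i : Fin d) :
    (adagrad η τ g x₀ (n + 1) - adagrad η τ g x₀ n) i =
      -(η * gradient g (adagrad η τ g x₀ n) i /
        (√(∑ k ∈ Finset.range (n + 1), gradient g (adagrad η τ g x₀ k) i ^ 2) + τ)) := by
  have h : adagrad η τ g x₀ (n + 1) i = adagrad η τ g x₀ n i -
      η * gradient g (adagrad η τ g x₀ n) i /
        (√((adagradState η τ g x₀ (n + 1)).2 i) + τ) := rfl
  rw [adagradState_snd] at h
  simp only [PiLp.sub_apply, h]
  ring

/-- The accumulator already contains the current gradient entry, so its root dominates that entry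
whatever its size. -/
lemma abs_adagrad_succ_sub_le (hη : 0 < η) (hτ : 0 < τ) (n : ℕ) (i : Fin d) :
    |(adagrad η τ g x₀ (n + 1) - adagrad η τ g x₀ n) i| ≤ η := by
  rw [adagrad_succ_sub, abs_neg, abs_div, abs_mul, abs_of_pos hη,
    abs_of_pos (a := √_ + τ) (by positivity), div_le_iff₀ (by positivity)]
  have h : |gradient g (adagrad η τ g x₀ n) i| ≤
      √(∑ k ∈ Finset.range (n + 1), gradient g (adagrad η τ g x₀ k) i ^ 2) := by
    rw [← Real.sqrt_sq_eq_abs]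
    exact Real.sqrt_le_sqrt (Finset.single_le_sum
      (f := fun k => gradient g (adagrad η τ g x₀ k) i ^ 2)
      (fun _ _ => sq_nonneg _) (Finset.self_mem_range_succ n))
  gcongr
  linarith

lemma norm_le_sqrt_card_mul {x : Vec d} {b : ℝ} (hb : 0 ≤ b) (hx : ∀ i, |x i| ≤ b) :
    ‖x‖ ≤ √(d : ℝ) * b := by
  rw [EuclideanSpace.norm_eq]
  refine Real.sqrt_le_iff.2 ⟨by positivity, ?_⟩
  rw [mul_pow, Real.sq_sqrt (by positivity)]
  calc ∑ i, ‖x i‖ ^ 2 ≤ ∑ _i : Fin d, b ^ 2 :=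
        Finset.sum_le_sum fun i _ => by rw [Real.norm_eq_abs]; gcongr; exact hx i
    _ = d * b ^ 2 := by simp

lemma norm_adagrad_succ_sub_le (hη : 0 < η) (hτ : 0 < τ) (n : ℕ) :
    ‖adagrad η τ g x₀ (n + 1) - adagrad η τ g x₀ n‖ ≤ √(d : ℝ) * η :=
  norm_le_sqrt_card_mul hη.le (abs_adagrad_succ_sub_le hη hτ n)

/-- The quadratic upper bound for `g` between `x` and `y` with coordinate constants `M`. -/
def DescentAt (g : Vec d → ℝ) (M : Fin d → ℝ) (x y : Vec d) : Prop :=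
  g y ≤ g x + inner ℝ (gradient g x) (y - x) + 1 / 2 * ∑ i, M i * (y - x) i ^ 2

/-- The function decrease accumulated over `n` Adagrad steps. -/
lemma adagrad_descent (hη : 0 < η) (hτ : 0 < τ) {M : Fin d → ℝ} (hM : ∀ i, 0 ≤ M i)
    {n : ℕ} {l : ℝ}
    (hdesc : ∀ k < n, DescentAt g M (adagrad η τ g x₀ k) (adagrad η τ g x₀ (k + 1)))
    (hl : ∀ i, Real.log (1 + (∑ k ∈ Finset.range n,
      gradient g (adagrad η τ g x₀ k) i ^ 2) / τ ^ 2) ≤ l) :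
    g (adagrad η τ g x₀ n) + η * ∑ i, ∑ k ∈ Finset.range n,
      gradient g (adagrad η τ g x₀ k) i ^ 2 /
        (√(∑ j ∈ Finset.range (k + 1), gradient g (adagrad η τ g x₀ j) i ^ 2) + τ) ≤
      g x₀ + η ^ 2 / 2 * (∑ i, M i) * l := by
  set x := adagrad η τ g x₀ with hx
  set w : ℕ → Fin d → ℝ := fun k i =>
    √(∑ j ∈ Finset.range (k + 1), gradient g (x j) i ^ 2) + τ with hw
  have hwpos : ∀ k i, 0 < w k i := fun k i => by positivity
  have hstep : ∀ k < n, g (x (k + 1)) - g (x k) ≤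
      ∑ i, (-(η * (gradient g (x k) i ^ 2 / w k i)) +
        η ^ 2 / 2 * M i * (gradient g (x k) i ^ 2 / w k i ^ 2)) := by
    intro k hk
    have h := hdesc k hk
    unfold DescentAt at h
    rw [PiLp.inner_apply] at h
    have e : ∀ i, (x (k + 1) - x k) i = -(η * gradient g (x k) i / w k i) :=
      fun i => adagrad_succ_sub k i
    refine (sub_le_iff_le_add'.2 (h.trans_eq ?_))
    rw [add_assoc, Finset.mul_sum, ← Finset.sum_add_distrib]
    congr 1
    refine Finset.sum_congr rfl fun i _ => ?_
    rw [e i]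
    have := (hwpos k i).ne'
    simp only [RCLike.inner_apply, conj_trivial]
    field_simp
  have hsum : g (x n) - g (x 0) ≤ ∑ k ∈ Finset.range n,
      ∑ i, (-(η * (gradient g (x k) i ^ 2 / w k i)) +
        η ^ 2 / 2 * M i * (gradient g (x k) i ^ 2 / w k i ^ 2)) := by
    rw [← Finset.sum_range_sub (fun k => g (x k))]
    exact Finset.sum_le_sum fun k hk => hstep k (Finset.mem_range.1 hk)
  rw [Finset.sum_comm] at hsum
  simp only [Finset.sum_add_distrib, Finset.sum_neg_distrib, ← Finset.mul_sum] at hsum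
  have hlog : ∑ i, η ^ 2 / 2 * M i * ∑ k ∈ Finset.range n, gradient g (x k) i ^ 2 / w k i ^ 2 ≤
      η ^ 2 / 2 * (∑ i, M i) * l := by
    rw [Finset.mul_sum, Finset.sum_mul]
    refine Finset.sum_le_sum fun i _ => ?_
    have := (sum_sq_div_sq_le_log (fun k => gradient g (x k) i) hτ n).trans (hl i)
    have h0 : 0 ≤ η ^ 2 / 2 * M i := mul_nonneg (by positivity) (hM i)
    exact mul_le_mul_of_nonneg_left this h0
  have : g (x 0) = g x₀ := rfl
  linarith

lemma adagrad_le_initial (hη : 0 < η) (hτ : 0 < τ) {M : Fin d → ℝ} (hM : ∀ i, 0 ≤ M i)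
    {n : ℕ} {l : ℝ}
    (hdesc : ∀ k < n, DescentAt g M (adagrad η τ g x₀ k) (adagrad η τ g x₀ (k + 1)))
    (hl : ∀ i, Real.log (1 + (∑ k ∈ Finset.range n,
      gradient g (adagrad η τ g x₀ k) i ^ 2) / τ ^ 2) ≤ l) :
    g (adagrad η τ g x₀ n) ≤ g x₀ + η ^ 2 / 2 * (∑ i, M i) * l := by
  have h := adagrad_descent hη hτ hM hdesc hl
  have h0 : 0 ≤ η * ∑ i, ∑ k ∈ Finset.range n, gradient g (adagrad η τ g x₀ k) i ^ 2 /
        (√(∑ j ∈ Finset.range (k + 1), gradient g (adagrad η τ g x₀ j) i ^ 2) + τ) := by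
    refine mul_nonneg hη.le (Finset.sum_nonneg fun i _ => Finset.sum_nonneg fun k _ => ?_)
    positivity
  linarith

/-- The regret-type bound for the summed `ℓ¹` gradient norms of Adagrad. -/
lemma sum_l1norm_adagrad_le (hη : 0 < η) (hτ : 0 < τ) {M : Fin d → ℝ} (hM : ∀ i, 0 ≤ M i)
    {n : ℕ} {l D : ℝ}
    (hdesc : ∀ k < n, DescentAt g M (adagrad η τ g x₀ k) (adagrad η τ g x₀ (k + 1)))
    (hl : ∀ i, Real.log (1 + (∑ k ∈ Finset.range n,
      gradient g (adagrad η τ g x₀ k) i ^ 2) / τ ^ 2) ≤ l)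
    (hD : g x₀ - g (adagrad η τ g x₀ n) ≤ D) :
    ∑ t ∈ Finset.range n, l1norm (gradient g (adagrad η τ g x₀ t)) ≤
      √(n : ℝ) * (D / η + d * τ + η / 2 * (∑ i, M i) * l) := by
  have h := adagrad_descent hη hτ hM hdesc hl
  set x := adagrad η τ g x₀ with hx
  -- Cauchy–Schwarz over time in each coordinate; this is the source of the `1 / √T` rate.
  have h1 : ∑ t ∈ Finset.range n, l1norm (gradient g (x t)) ≤
      √(n : ℝ) * ∑ i, √(∑ k ∈ Finset.range n, gradient g (x k) i ^ 2) := by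
    unfold l1norm
    rw [Finset.sum_comm, Finset.mul_sum]
    refine Finset.sum_le_sum fun i _ => ?_
    rw [← Real.sqrt_mul (by positivity)]
    refine Real.le_sqrt_of_sq_le ?_
    have := sq_sum_le_card_mul_sum_sq (s := Finset.range n) (f := fun t => |gradient g (x t) i|)
    simpa using this
  refine h1.trans (mul_le_mul_of_nonneg_left ?_ (Real.sqrt_nonneg _))
  have h2 : ∑ i, (√(∑ k ∈ Finset.range n, gradient g (x k) i ^ 2) - τ) ≤
      ∑ i, ∑ k ∈ Finset.range n, gradient g (x k) i ^ 2 /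
        (√(∑ j ∈ Finset.range (k + 1), gradient g (x j) i ^ 2) + τ) :=
    Finset.sum_le_sum fun i _ => sqrt_sub_le_sum_sq_div _ hτ n
  rw [Finset.sum_sub_distrib] at h2
  simp only [Finset.sum_const, Finset.card_univ, Fintype.card_fin, nsmul_eq_mul] at h2
  have h3 := mul_le_mul_of_nonneg_left h2 hη.le
  set Z := ∑ i, √(∑ k ∈ Finset.range n, gradient g (x k) i ^ 2)
  have h4 : η * (Z - d * τ) ≤ D + η ^ 2 / 2 * (∑ i, M i) * l := by linarith
  have h5 : Z - d * τ ≤ (D + η ^ 2 / 2 * (∑ i, M i) * l) / η := by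
    rw [le_div_iff₀ hη]; linarith
  have h6 : (D + η ^ 2 / 2 * (∑ i, M i) * l) / η = D / η + η / 2 * (∑ i, M i) * l := by
    field_simp
  linarith

/-! ### Gradients along the trajectory of a function with Lipschitz gradient -/

lemma abs_apply_le_norm (x : Vec d) (i : Fin d) : |x i| ≤ ‖x‖ := by
  simpa using PiLp.norm_apply_le x i

/-- Steps have length at most `√d η`, so gradients grow at most linearly in time. This keeps the
argument of the logarithm polynomial. -/
lemma norm_gradient_adagrad_le (hη : 0 < η) (hτ : 0 < τ) {K : ℝ} (hK : 0 ≤ K)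
    (hlip : ∀ x y, ‖gradient g y - gradient g x‖ ≤ K * ‖y - x‖) (n : ℕ) :
    ‖gradient g (adagrad η τ g x₀ n)‖ ≤ ‖gradient g x₀‖ + n * (K * (√(d : ℝ) * η)) := by
  induction n with
  | zero => simp [adagrad_zero]
  | succ n ih =>
    have h1 := hlip (adagrad η τ g x₀ n) (adagrad η τ g x₀ (n + 1))
    have h2 := mul_le_mul_of_nonneg_left (norm_adagrad_succ_sub_le (g := g) (x₀ := x₀) hη hτ n) hK
    have h3 := norm_sub_norm_le (gradient g (adagrad η τ g x₀ (n + 1)))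
      (gradient g (adagrad η τ g x₀ n))
    push_cast
    linarith

/-- A bound on the logarithmic factor in Adagrad for a function with Lipschitz gradient. -/
lemma log_accumulator_le (hη : 0 < η) (hτ : 0 < τ) {K G : ℝ} (hK : 0 ≤ K)
    (hlip : ∀ x y, ‖gradient g y - gradient g x‖ ≤ K * ‖y - x‖)
    (hG : ‖gradient g x₀‖ ≤ √(d : ℝ) * G) {n T : ℕ} (hn : n ≤ T) (i : Fin d) :
    Real.log (1 + (∑ k ∈ Finset.range n, gradient g (adagrad η τ g x₀ k) i ^ 2) / τ ^ 2) ≤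
      Real.log (3 + T * (d * (G + T * (K * η)) ^ 2) * (1 / τ) ^ 2) := by
  have hS0 : 0 ≤ ∑ k ∈ Finset.range n, gradient g (adagrad η τ g x₀ k) i ^ 2 :=
    Finset.sum_nonneg fun _ _ => sq_nonneg _
  refine Real.log_le_log (by positivity) ?_
  have hterm : ∀ k ∈ Finset.range T,
      gradient g (adagrad η τ g x₀ k) i ^ 2 ≤ d * (G + T * (K * η)) ^ 2 := by
    intro k hk
    have hkT : (k : ℝ) ≤ T := by exact_mod_cast (Finset.mem_range.1 hk).le
    have h1 : |gradient g (adagrad η τ g x₀ k) i| ≤ √(d : ℝ) * (G + T * (K * η)) := by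
      refine (abs_apply_le_norm _ i).trans ((norm_gradient_adagrad_le hη hτ hK hlip k).trans ?_)
      have : (k : ℝ) * (K * (√(d : ℝ) * η)) ≤ T * (K * (√(d : ℝ) * η)) := by gcongr
      linarith
    rw [← sq_abs]
    calc |gradient g (adagrad η τ g x₀ k) i| ^ 2 ≤ (√(d : ℝ) * (G + T * (K * η))) ^ 2 := by gcongr
      _ = _ := by rw [mul_pow, Real.sq_sqrt (by positivity)]
  have hS : ∑ k ∈ Finset.range n, gradient g (adagrad η τ g x₀ k) i ^ 2 ≤
      T * (d * (G + T * (K * η)) ^ 2) := by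
    calc _ ≤ ∑ k ∈ Finset.range T, gradient g (adagrad η τ g x₀ k) i ^ 2 :=
          Finset.sum_le_sum_of_subset_of_nonneg (Finset.range_subset_range.2 hn)
            fun _ _ _ => sq_nonneg _
      _ ≤ ∑ _k ∈ Finset.range T, d * (G + T * (K * η)) ^ 2 := Finset.sum_le_sum hterm
      _ = _ := by simp
  have : (∑ k ∈ Finset.range n, gradient g (adagrad η τ g x₀ k) i ^ 2) / τ ^ 2 ≤
      T * (d * (G + T * (K * η)) ^ 2) * (1 / τ) ^ 2 := by
    rw [one_div, inv_pow, ← div_eq_mul_inv]; gcongr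
  linarith

/-! ### Consequences of coordinate-wise smoothness -/

section Smooth

variable {d : ℕ} {f : Vec d → ℝ} {L : Fin d → ℝ}

lemma CoordSmooth.descentAt (hL : CoordSmooth f L) (x y : Vec d) : DescentAt f L x y := by
  have h := (abs_le.1 (hL.2 y x)).2
  simp only [← PiLp.sub_apply] at h
  unfold DescentAt
  linarith

lemma sum_mul_sq_le (hL : ∀ i, 0 ≤ L i) (u : Vec d) :
    ∑ i, L i * u i ^ 2 ≤ (∑ i, L i) * ‖u‖ ^ 2 := by
  rw [Finset.sum_mul]
  refine Finset.sum_le_sum fun i _ => mul_le_mul_of_nonneg_left ?_ (hL i)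
  rw [← sq_abs]
  gcongr
  exact abs_apply_le_norm u i

/-- Smoothness is applied to the pairs `(y + u, x)`, `(y + u, y)`, `(y, x)`; function values cancel
and leave the gradient difference paired with `u`. Choosing `u` along that difference with length
`‖y - x‖` gives the factor `3`. -/
lemma CoordSmooth.norm_gradient_sub_le (hL : CoordSmooth f L) (x y : Vec d) :
    ‖gradient f y - gradient f x‖ ≤ 3 * (∑ i, L i) * ‖y - x‖ := by
  have hL0 : ∀ i, 0 ≤ L i := fun i => (hL.1 i).le
  have key : ∀ u : Vec d, inner ℝ (gradient f y - gradient f x) u ≤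
      3 / 2 * (∑ i, L i) * (‖u‖ ^ 2 + ‖y - x‖ ^ 2) := by
    intro u
    have h1 := (abs_le.1 (hL.2 (y + u) x)).2
    have h2 := (abs_le.1 (hL.2 (y + u) y)).1
    have h3 := (abs_le.1 (hL.2 y x)).1
    simp only [← PiLp.sub_apply] at h1 h2 h3
    have e1 : y + u - x = (y - x) + u := by abel
    have e2 : y + u - y = u := by abel
    rw [e1] at h1
    rw [e2] at h2
    rw [inner_add_right] at h1
    have hq : ∑ i, L i * ((y - x) + u) i ^ 2 ≤
        2 * ∑ i, L i * (y - x) i ^ 2 + 2 * ∑ i, L i * u i ^ 2 := by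
      rw [Finset.mul_sum, Finset.mul_sum, ← Finset.sum_add_distrib]
      refine Finset.sum_le_sum fun i _ => ?_
      have := mul_nonneg (hL0 i) (sq_nonneg ((y - x) i - u i))
      rw [PiLp.add_apply]
      nlinarith
    have q1 := sum_mul_sq_le hL0 u
    have q2 := sum_mul_sq_le hL0 (y - x)
    rw [inner_sub_left]
    linarith
  set Δ := gradient f y - gradient f x with hΔ
  rcases eq_or_ne Δ 0 with h0 | h0
  · rw [h0, norm_zero]
    have := Finset.sum_nonneg fun i (_ : i ∈ Finset.univ) => hL0 i
    positivity
  rcases eq_or_ne (y - x) 0 with h1 | h1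
  · rw [sub_eq_zero.1 h1, sub_self] at hΔ
    exact absurd hΔ h0
  have hn : 0 < ‖Δ‖ := norm_pos_iff.2 h0
  have hm : 0 < ‖y - x‖ := norm_pos_iff.2 h1
  have h := key ((‖y - x‖ / ‖Δ‖) • Δ)
  rw [inner_smul_right, real_inner_self_eq_norm_sq, norm_smul, Real.norm_eq_abs,
    abs_of_pos (by positivity), div_mul_cancel₀ _ hn.ne'] at h
  have e : ‖y - x‖ / ‖Δ‖ * ‖Δ‖ ^ 2 = ‖y - x‖ * ‖Δ‖ := by field_simp
  rw [e] at h
  nlinarith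

lemma norm_le_sqrt_card_mul_linftyNorm (x : Vec d) : ‖x‖ ≤ √(d : ℝ) * linftyNorm x :=
  norm_le_sqrt_card_mul (norm_nonneg _) fun i => norm_le_pi_norm x.ofLp i

end Smooth

/-! ### Second-order expansion around a local minimum -/

section Hessian

variable {d : ℕ} {f : Vec d → ℝ} {θ : Vec d} {H : ℝ}

lemma TwiceDifferentiable.hasFDerivAt_gradient (hf : TwiceDifferentiable f) (x : Vec d) :
    HasFDerivAt (gradient f) (hessian f x) x :=
  (hf.2 x).hasFDerivAt

lemma TwiceDifferentiable.hasFDerivAt (hf : TwiceDifferentiable f) (x : Vec d) :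
    HasFDerivAt f (innerSL ℝ (gradient f x)) x :=
  (hf.1 x).hasGradientAt.hasFDerivAt

lemma TwiceDifferentiable.isSymmetric_hessian (hf : TwiceDifferentiable f) (x : Vec d) :
    (hessian f x : Vec d →ₗ[ℝ] Vec d).IsSymmetric := by
  intro v w
  have h : HasFDerivAt (fun y => innerSL ℝ (gradient f y))
      ((innerSL ℝ : Vec d →L[ℝ] Vec d →L[ℝ] ℝ).comp (hessian f x)) x :=
    (innerSL ℝ : Vec d →L[ℝ] Vec d →L[ℝ] ℝ).hasFDerivAt.comp x (hf.hasFDerivAt_gradient x)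
  have := second_derivative_symmetric hf.hasFDerivAt h v w
  simp only [ContinuousLinearMap.comp_apply, innerSL_apply_apply] at this
  rw [ContinuousLinearMap.coe_coe, this, real_inner_comm]

lemma HessianLipschitz.nonneg [NeZero d] (hH : HessianLipschitz f H) : 0 ≤ H := by
  have h := (norm_nonneg _).trans (hH (EuclideanSpace.single 0 1) 0)
  simpa using h

lemma gradient_eq_zero_of_isLocalMin (hmin : IsLocalMin f θ) : gradient f θ = 0 := by
  simp [gradient, hmin.fderiv_eq_zero]

/-- Mean value inequality for the gradient on a ball around `θ`, where the Hessian stays within `H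
R` of its value at the centre. -/
lemma norm_gradient_sub_sub_hessian_le (hf : TwiceDifferentiable f) (hH : HessianLipschitz f H)
    (hH0 : 0 ≤ H) {R : ℝ} {x y : Vec d} (hx : ‖x - θ‖ ≤ R) (hy : ‖y - θ‖ ≤ R) :
    ‖gradient f y - gradient f x - hessian f θ (y - x)‖ ≤ H * R * ‖y - x‖ := by
  refine (convex_closedBall θ R).norm_image_sub_le_of_norm_hasFDerivWithin_le'
    (fun z _ => (hf.hasFDerivAt_gradient z).hasFDerivWithinAt) (fun z hz => ?_) ?_ ?_
  · refine (hH z θ).trans (mul_le_mul_of_nonneg_left ?_ hH0)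
    rwa [mem_closedBall_iff_norm] at hz
  · rwa [mem_closedBall_iff_norm]
  · rwa [mem_closedBall_iff_norm]

lemma norm_gradient_sub_hessian_le (hf : TwiceDifferentiable f) (hH : HessianLipschitz f H)
    (hH0 : 0 ≤ H) (hmin : IsLocalMin f θ) (y : Vec d) :
    ‖gradient f y - hessian f θ (y - θ)‖ ≤ H * ‖y - θ‖ ^ 2 := by
  have h := norm_gradient_sub_sub_hessian_le (θ := θ) hf hH hH0 (x := θ) (y := y)
    (R := ‖y - θ‖) (by simp) le_rfl
  rw [gradient_eq_zero_of_isLocalMin hmin, sub_zero] at h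
  linarith

/-- The quadratic term uses the Hessian at the fixed centre `θ`, not at `x`, so that one matrix
serves the whole trajectory. The proof is the mean value inequality along the segment from `x` to
`y`. -/
lemma abs_sub_quadratic_le (hf : TwiceDifferentiable f) (hH : HessianLipschitz f H)
    (hH0 : 0 ≤ H) {R : ℝ} {x y : Vec d} (hx : ‖x - θ‖ ≤ R) (hy : ‖y - θ‖ ≤ R) :
    |f y - f x - inner ℝ (gradient f x) (y - x) -
      1 / 2 * inner ℝ (hessian f θ (y - x)) (y - x)| ≤ H * R * ‖y - x‖ ^ 2 := by
  set h := y - x with hh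
  set A := hessian f θ with hA
  have hR : 0 ≤ R := (norm_nonneg _).trans hx
  set φ : ℝ → ℝ := fun t => f (x + t • h) - t * inner ℝ (gradient f x) h -
    t ^ 2 * (1 / 2 * inner ℝ (A h) h) with hφ
  have hderiv : ∀ t, HasDerivAt φ (inner ℝ (gradient f (x + t • h)) h -
      inner ℝ (gradient f x) h - 2 * t * (1 / 2 * inner ℝ (A h) h)) t := by
    intro t
    have hline : HasDerivAt (fun t : ℝ => x + t • h) h t := by
      simpa using ((hasDerivAt_id t).smul_const h).const_add x
    have h1 : HasDerivAt (fun t => f (x + t • h)) (inner ℝ (gradient f (x + t • h)) h) t := by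
      have h0 := hf.hasFDerivAt (x + t • h)
      exact h0.comp_hasDerivAt t hline
    have h2 := (hasDerivAt_id t).mul_const (inner ℝ (gradient f x) h)
    have h3 := (hasDerivAt_pow 2 t).mul_const (1 / 2 * inner ℝ (A h) h)
    exact ((h1.sub h2).sub h3).congr_deriv (by norm_num)
  have hbound : ∀ t ∈ Set.Ico (0 : ℝ) 1, ‖inner ℝ (gradient f (x + t • h)) h -
      inner ℝ (gradient f x) h - 2 * t * (1 / 2 * inner ℝ (A h) h)‖ ≤ H * R * ‖h‖ ^ 2 := by
    intro t ht
    have hz : ‖x + t • h - θ‖ ≤ R := by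
      have := (convex_closedBall θ R).add_smul_sub_mem
        (mem_closedBall_iff_norm.2 hx) (mem_closedBall_iff_norm.2 hy) ⟨ht.1, ht.2.le⟩
      rwa [mem_closedBall_iff_norm] at this
    have hg := norm_gradient_sub_sub_hessian_le (θ := θ) hf hH hH0 hx hz
    have e : inner ℝ (gradient f (x + t • h)) h -
      inner ℝ (gradient f x) h - 2 * t * (1 / 2 * inner ℝ (A h) h) =
      inner ℝ (gradient f (x + t • h) - gradient f x - A (x + t • h - x)) h := by
      rw [add_sub_cancel_left, map_smul, inner_sub_left, inner_sub_left, inner_smul_left]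
      simp only [conj_trivial]
      ring
    rw [e]
    refine (norm_inner_le_norm _ _).trans ?_
    rw [add_sub_cancel_left, norm_smul, Real.norm_eq_abs, abs_of_nonneg ht.1] at hg
    rw [add_sub_cancel_left]
    have : H * R * (t * ‖h‖) ≤ H * R * (1 * ‖h‖) := by gcongr; exact ht.2.le
    calc _ ≤ H * R * (1 * ‖h‖) * ‖h‖ := by gcongr; exact hg.trans this
      _ = _ := by ring
  have := norm_image_sub_le_of_norm_deriv_le_segment_01'
    (fun t _ => (hderiv t).hasDerivWithinAt) hbound
  rw [Real.norm_eq_abs] at this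
  convert this using 2
  simp only [hφ]
  rw [one_smul, zero_smul, add_zero, hh]
  simp
  ring

/-- Letting `t → 0⁺` removes the cubic Taylor remainder after division by `t²`; both second-order
conditions below use it. -/
lemma nonneg_of_forall_neg_mul_le {a b : ℝ} {P : ℝ → Prop}
    (hP : ∀ᶠ t in nhdsWithin (0 : ℝ) (Set.Ioi 0), P t)
    (h : ∀ t, 0 < t → P t → -(b * t) ≤ a) : 0 ≤ a := by
  have h1 : Filter.Tendsto (fun t : ℝ => -(b * t)) (nhdsWithin 0 (Set.Ioi 0)) (nhds 0) := by
    have : Filter.Tendsto (fun t : ℝ => -(b * t)) (nhds 0) (nhds (-(b * 0))) :=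
      (Continuous.tendsto (by fun_prop) 0)
    simpa using this.mono_left nhdsWithin_le_nhds
  refine le_of_tendsto h1 ?_
  filter_upwards [hP, self_mem_nhdsWithin] with t ht ht0
  exact h t ht0 ht

lemma quadratic_expansion_ray (hf : TwiceDifferentiable f) (hH : HessianLipschitz f H)
    (hH0 : 0 ≤ H) (hmin : IsLocalMin f θ) (v : Vec d) {t : ℝ} (ht : 0 < t) :
    |f (θ + t • v) - f θ - t ^ 2 * (1 / 2 * inner ℝ (hessian f θ v) v)| ≤
      t ^ 2 * (H * ‖v‖ ^ 3 * t) := by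
  have h := abs_sub_quadratic_le (θ := θ) hf hH hH0 (x := θ) (y := θ + t • v)
    (R := t * ‖v‖) (by simp; positivity) (by simp [norm_smul, abs_of_pos ht])
  rw [gradient_eq_zero_of_isLocalMin hmin, inner_zero_left, sub_zero, add_sub_cancel_left,
    map_smul, inner_smul_left, inner_smul_right, norm_smul, Real.norm_eq_abs, abs_of_pos ht] at h
  simp only [conj_trivial] at h
  calc _ = |f (θ + t • v) - f θ - 1 / 2 * (t * (t * inner ℝ (hessian f θ v) v))| := by
        congr 2; ring
    _ ≤ _ := h
    _ = _ := by ring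

/-- The second-order necessary condition at a local minimum. -/
lemma inner_hessian_nonneg (hf : TwiceDifferentiable f) (hH : HessianLipschitz f H)
    (hH0 : 0 ≤ H) (hmin : IsLocalMin f θ) (v : Vec d) : 0 ≤ inner ℝ (hessian f θ v) v := by
  have hlim : Filter.Tendsto (fun t : ℝ => θ + t • v) (nhdsWithin 0 (Set.Ioi 0)) (nhds θ) := by
    have : Filter.Tendsto (fun t : ℝ => θ + t • v) (nhds 0) (nhds (θ + (0 : ℝ) • v)) :=
      (Continuous.tendsto (by fun_prop) 0)
    simpa using this.mono_left nhdsWithin_le_nhds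
  refine nonneg_of_forall_neg_mul_le (b := 2 * (H * ‖v‖ ^ 3)) (hlim.eventually hmin)
    fun t ht h => ?_
  have h1 := (abs_le.1 (quadratic_expansion_ray hf hH hH0 hmin v ht)).2
  have h2 : 0 ≤ t ^ 2 * (1 / 2 * inner ℝ (hessian f θ v) v + H * ‖v‖ ^ 3 * t) := by linarith
  have h3 := nonneg_of_mul_nonneg_right h2 (by positivity)
  linarith

/-- Coordinate-wise smoothness bounds the Hessian at a local minimum. -/
lemma inner_hessian_le_sum (hf : TwiceDifferentiable f) (hH : HessianLipschitz f H)
    (hH0 : 0 ≤ H) (hmin : IsLocalMin f θ) {L : Fin d → ℝ} (hL : CoordSmooth f L) (v : Vec d) :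
    inner ℝ (hessian f θ v) v ≤ ∑ i, L i * v i ^ 2 := by
  rw [← sub_nonneg]
  refine nonneg_of_forall_neg_mul_le (b := 2 * (H * ‖v‖ ^ 3)) (P := fun _ => True)
    (by simp) fun t ht _ => ?_
  have h1 := (abs_le.1 (quadratic_expansion_ray hf hH hH0 hmin v ht)).1
  have h2 := (abs_le.1 (hL.2 (θ + t • v) θ)).2
  have e : ∑ i, L i * ((θ + t • v) i - θ i) ^ 2 = t ^ 2 * ∑ i, L i * v i ^ 2 := by
    rw [Finset.mul_sum]
    refine Finset.sum_congr rfl fun i _ => ?_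
    simp
    ring
  rw [e, gradient_eq_zero_of_isLocalMin hmin, inner_zero_left] at h2
  have h3 : 0 ≤ t ^ 2 * ((1 / 2) * ∑ i, L i * v i ^ 2 -
      1 / 2 * inner ℝ (hessian f θ v) v + H * ‖v‖ ^ 3 * t) := by linarith
  have h4 := nonneg_of_mul_nonneg_right h3 (by positivity)
  linarith

end Hessian

/-! ### Symmetric operators -/

section Symmetric

variable {d : ℕ} {A : Vec d →L[ℝ] Vec d}

/-- The largest eigenvalue of a symmetric operator is attained and bounds the quadratic form. -/
lemma exists_unit_eigenvector_lambdaMax [NeZero d] (hA : (A : Vec d →ₗ[ℝ] Vec d).IsSymmetric) :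
    (∃ u : Vec d, ‖u‖ = 1 ∧ A u = lambdaMax A • u) ∧
      ∀ x, inner ℝ (A x) x ≤ lambdaMax A * ‖x‖ ^ 2 := by
  have hfin : Module.finrank ℝ (Vec d) = d := by simp
  let b := hA.eigenvectorBasis hfin
  let μ := hA.eigenvalues hfin
  have hb : ∀ i, A (b i) = μ i • b i := fun i => hA.apply_eigenvectorBasis hfin i
  have hbdd : BddAbove {ν : ℝ | Module.End.HasEigenvalue (A : Vec d →ₗ[ℝ] Vec d) ν} :=
    (Module.End.finite_hasEigenvalue (A : Vec d →ₗ[ℝ] Vec d)).bddAbove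
  have hmem : ∀ i, Module.End.HasEigenvalue (A : Vec d →ₗ[ℝ] Vec d) (μ i) :=
    fun i => hA.hasEigenvalue_eigenvalues hfin i
  have hle : ∀ i, μ i ≤ lambdaMax A := fun i => le_csSup hbdd (hmem i)
  refine ⟨?_, fun x => ?_⟩
  · have hmax : Module.End.HasEigenvalue (A : Vec d →ₗ[ℝ] Vec d) (lambdaMax A) :=
      (Set.Nonempty.csSup_mem ⟨_, hmem 0⟩
        (Module.End.finite_hasEigenvalue (A : Vec d →ₗ[ℝ] Vec d)))
    obtain ⟨v, hv⟩ := hmax.exists_hasEigenvector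
    have hn : ‖v‖ ≠ 0 := norm_ne_zero_iff.2 hv.2
    refine ⟨‖v‖⁻¹ • v, by rw [norm_smul, norm_inv, norm_norm, inv_mul_cancel₀ hn], ?_⟩
    have h := hv.apply_eq_smul
    rw [ContinuousLinearMap.coe_coe] at h
    rw [map_smul, h, smul_comm]
  · have h1 : inner ℝ (A x) x = ∑ i, μ i * inner ℝ (b i) x ^ 2 := by
      rw [← b.sum_inner_mul_inner (A x) x]
      refine Finset.sum_congr rfl fun i _ => ?_
      have : inner ℝ (A x) (b i) = μ i * inner ℝ (b i) x := by
        have h := hA x (b i)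
        simp only [ContinuousLinearMap.coe_coe] at h
        rw [h, hb, inner_smul_right, real_inner_comm]
      rw [this]
      ring
    have h2 : ‖x‖ ^ 2 = ∑ i, inner ℝ (b i) x ^ 2 := by
      rw [← b.sum_sq_norm_inner_right x]
      simp
    rw [h1, h2, Finset.mul_sum]
    exact Finset.sum_le_sum fun i _ => mul_le_mul_of_nonneg_right (hle i) (sq_nonneg _)

/-- The Cauchy–Schwarz inequality for a positive semidefinite operator. -/
lemma sq_inner_le_of_nonneg (hA : (A : Vec d →ₗ[ℝ] Vec d).IsSymmetric)
    (hpos : ∀ x, 0 ≤ inner ℝ (A x) x) (x y : Vec d) :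
    inner ℝ (A x) y ^ 2 ≤ inner ℝ (A x) x * inner ℝ (A y) y := by
  have hsymm : inner ℝ (A y) x = inner ℝ (A x) y := by
    have h := hA y x
    simp only [ContinuousLinearMap.coe_coe] at h
    rw [h, real_inner_comm]
  have h : ∀ t : ℝ, 0 ≤ inner ℝ (A y) y * (t * t) + 2 * inner ℝ (A x) y * t +
      inner ℝ (A x) x := by
    intro t
    have := hpos (x + t • y)
    simp only [map_add, map_smul, inner_add_left, inner_add_right, inner_smul_left,
      inner_smul_right, conj_trivial, hsymm] at this
    linarith
  have := discrim_le_zero h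
  rw [discrim] at this
  linarith

/-- Cauchy–Schwarz for the form of `A` at `x` and `A x` bounds `‖A x‖⁴` by `⟨A x, x⟩` times
`lambdaMax A * ‖A x‖²`; cancel `‖A x‖²`. -/
lemma sq_norm_le_of_nonneg [NeZero d] (hA : (A : Vec d →ₗ[ℝ] Vec d).IsSymmetric)
    (hpos : ∀ x, 0 ≤ inner ℝ (A x) x) (x : Vec d) :
    ‖A x‖ ^ 2 ≤ lambdaMax A * inner ℝ (A x) x := by
  have h1 := sq_inner_le_of_nonneg hA hpos x (A x)
  have h2 := (exists_unit_eigenvector_lambdaMax hA).2 (A x)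
  rw [real_inner_self_eq_norm_sq] at h1
  rcases eq_or_ne (A x) 0 with h0 | h0
  · simp [h0]
  have hn : 0 < ‖A x‖ ^ 2 := by positivity
  have h3 := mul_le_mul_of_nonneg_left h2 (hpos x)
  nlinarith

lemma lambdaMax_nonneg [NeZero d] (hA : (A : Vec d →ₗ[ℝ] Vec d).IsSymmetric)
    (hpos : ∀ x, 0 ≤ inner ℝ (A x) x) : 0 ≤ lambdaMax A := by
  obtain ⟨u, hu, hAu⟩ := (exists_unit_eigenvector_lambdaMax hA).1
  have h := hpos u
  rw [hAu, inner_smul_left, real_inner_self_eq_norm_sq, hu] at h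
  simpa using h

lemma norm_le_lambdaMax_mul [NeZero d] (hA : (A : Vec d →ₗ[ℝ] Vec d).IsSymmetric)
    (hpos : ∀ x, 0 ≤ inner ℝ (A x) x) (x : Vec d) : ‖A x‖ ≤ lambdaMax A * ‖x‖ := by
  have hl := lambdaMax_nonneg hA hpos
  refine le_of_sq_le_sq ?_ (by positivity)
  have h1 := sq_norm_le_of_nonneg hA hpos x
  have h2 := mul_le_mul_of_nonneg_left ((exists_unit_eigenvector_lambdaMax hA).2 x) hl
  nlinarith

/-- Monotonicity of the operator square root: `A² ≤ D²` implies `A ≤ D`. -/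
lemma inner_le_inner_of_norm_le [NeZero d] {D : Vec d →L[ℝ] Vec d}
    (hA : (A : Vec d →ₗ[ℝ] Vec d).IsSymmetric) (hD : (D : Vec d →ₗ[ℝ] Vec d).IsSymmetric)
    (hDpos : ∀ x, 0 ≤ inner ℝ (D x) x) (h : ∀ x, ‖A x‖ ^ 2 ≤ ‖D x‖ ^ 2) (x : Vec d) :
    inner ℝ (A x) x ≤ inner ℝ (D x) x := by
  have hAD : ((A - D : Vec d →L[ℝ] Vec d) : Vec d →ₗ[ℝ] Vec d).IsSymmetric := by
    rw [ContinuousLinearMap.toLinearMap_sub]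
    exact hA.sub hD
  obtain ⟨⟨u, hu, hAu⟩, hle⟩ := exists_unit_eigenvector_lambdaMax hAD
  -- At a unit eigenvector `u` of `A - D` with eigenvalue `ν > 0`, `‖A u‖² = ‖D u‖² + 2 ν ⟨D u, u⟩ +
  -- ν²` would exceed `‖D u‖²`.
  have hmu : lambdaMax (A - D) ≤ 0 := by
    by_contra! hpos
    have e : A u = D u + lambdaMax (A - D) • u := by
      rw [← hAu]; simp
    have h1 := h u
    rw [e, norm_add_sq_real, inner_smul_right, norm_smul, hu, Real.norm_eq_abs, mul_one,
      sq_abs] at h1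
    have := mul_nonneg hpos.le (hDpos u)
    nlinarith
  have h2 := hle x
  rw [sub_apply, inner_sub_left] at h2
  nlinarith [sq_nonneg ‖x‖]

end Symmetric

/-! ### Orthogonal changes of coordinates -/

section Orthogonal

variable {d : ℕ} {V : Matrix (Fin d) (Fin d) ℝ}

lemma inner_eq_dotProduct (x y : Vec d) : inner ℝ x y = x.ofLp ⬝ᵥ y.ofLp := by
  rw [EuclideanSpace.inner_eq_star_dotProduct, star_trivial, dotProduct_comm]

lemma inner_apply_left (V : Matrix (Fin d) (Fin d) ℝ) (x y : Vec d) :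
    inner ℝ (apply V x) y = inner ℝ x (apply V.transpose y) := by
  rw [inner_eq_dotProduct, inner_eq_dotProduct, apply, apply, dotProduct_comm,
    Matrix.dotProduct_mulVec, ← Matrix.mulVec_transpose, dotProduct_comm]

lemma apply_mul (V W : Matrix (Fin d) (Fin d) ℝ) (x : Vec d) :
    apply V (apply W x) = apply (V * W) x := by
  simp [apply, Matrix.mulVec_mulVec]

lemma apply_apply_transpose (hV : V ∈ Matrix.orthogonalGroup (Fin d) ℝ) (x : Vec d) :
    apply V (apply V.transpose x) = x := by
  have h : V * V.transpose = 1 := (Matrix.mem_orthogonalGroup_iff (Fin d) ℝ).1 hV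
  rw [apply_mul, h]
  simp [apply]

lemma apply_transpose_apply (hV : V ∈ Matrix.orthogonalGroup (Fin d) ℝ) (x : Vec d) :
    apply V.transpose (apply V x) = x := by
  have h : V.transpose * V = 1 := (Matrix.mem_orthogonalGroup_iff' (Fin d) ℝ).1 hV
  rw [apply_mul, h]
  simp [apply]

lemma norm_apply (hV : V ∈ Matrix.orthogonalGroup (Fin d) ℝ) (x : Vec d) :
    ‖apply V x‖ = ‖x‖ := by
  have h : ‖apply V x‖ ^ 2 = ‖x‖ ^ 2 := by
    rw [← real_inner_self_eq_norm_sq, inner_apply_left, apply_transpose_apply hV,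
      real_inner_self_eq_norm_sq]
  exact (sq_eq_sq₀ (norm_nonneg _) (norm_nonneg _)).1 h

lemma norm_apply_transpose (hV : V ∈ Matrix.orthogonalGroup (Fin d) ℝ) (x : Vec d) :
    ‖apply V.transpose x‖ = ‖x‖ := by
  rw [← norm_apply hV, apply_apply_transpose hV]

lemma apply_sub (V : Matrix (Fin d) (Fin d) ℝ) (x y : Vec d) :
    apply V (x - y) = apply V x - apply V y := by
  simp [apply, Matrix.mulVec_sub]

/-- `apply V` as a continuous linear map. -/
noncomputable def applyCLM (V : Matrix (Fin d) (Fin d) ℝ) : Vec d →L[ℝ] Vec d :=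
  Matrix.toEuclideanCLM (n := Fin d) (𝕜 := ℝ) V

lemma applyCLM_apply (V : Matrix (Fin d) (Fin d) ℝ) (x : Vec d) : applyCLM V x = apply V x := rfl

lemma gradient_comp_apply {f : Vec d → ℝ} (hf : Differentiable ℝ f)
    (V : Matrix (Fin d) (Fin d) ℝ) (x : Vec d) :
    gradient (fun x => f (apply V x)) x = apply V.transpose (gradient f (apply V x)) := by
  refine HasGradientAt.gradient (hasGradientAt_iff_hasFDerivAt.2 ?_)
  have h := (hf (apply V x)).hasGradientAt.hasFDerivAt.comp x (applyCLM V).hasFDerivAt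
  refine h.congr_fderiv ?_
  ext w
  have e := inner_apply_left V w (gradient f (apply V x))
  rw [real_inner_comm, real_inner_comm _ w] at e
  simpa [applyCLM_apply] using e

/-- The quadratic form of `V diag(lam) Vᵀ`. -/
lemma dotProduct_eigendecomposition (V : Matrix (Fin d) (Fin d) ℝ) (lam : Fin d → ℝ) (w : Vec d) :
    w.ofLp ⬝ᵥ (V * Matrix.diagonal lam * V.transpose).mulVec w.ofLp =
      ∑ k, lam k * apply V.transpose w k ^ 2 := by
  rw [← Matrix.mulVec_mulVec, ← Matrix.mulVec_mulVec, Matrix.dotProduct_mulVec,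
    ← Matrix.mulVec_transpose, dotProduct]
  refine Finset.sum_congr rfl fun k _ => ?_
  rw [Matrix.mulVec_diagonal]
  simp only [apply]
  ring

/-- The operator `V diag(D) Vᵀ`: its symmetry, quadratic form and norm. -/
lemma diagonal_operator (hV : V ∈ Matrix.orthogonalGroup (Fin d) ℝ) (D : Fin d → ℝ) :
    (applyCLM (V * Matrix.diagonal D * V.transpose) : Vec d →ₗ[ℝ] Vec d).IsSymmetric ∧
    (∀ x, inner ℝ (applyCLM (V * Matrix.diagonal D * V.transpose) x) x =
      ∑ k, D k * apply V.transpose x k ^ 2) ∧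
    ∀ x, ‖applyCLM (V * Matrix.diagonal D * V.transpose) x‖ ^ 2 =
      ∑ k, D k ^ 2 * apply V.transpose x k ^ 2 := by
  refine ⟨fun x y => ?_, fun x => ?_, fun x => ?_⟩
  · simp only [ContinuousLinearMap.coe_coe, applyCLM_apply]
    rw [inner_apply_left]
    simp [Matrix.transpose_mul, Matrix.mul_assoc]
  · rw [← dotProduct_eigendecomposition, applyCLM_apply, real_inner_comm, inner_eq_dotProduct,
      apply]
  · rw [applyCLM_apply, ← apply_mul, ← apply_mul, norm_apply hV, EuclideanSpace.norm_sq_eq]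
    refine Finset.sum_congr rfl fun k _ => ?_
    simp only [apply, Matrix.mulVec_diagonal, Real.norm_eq_abs, sq_abs]
    ring

end Orthogonal

/-! ### Second moments and the quadratic form of the EGOP -/

section Moments

lemma centralMoment_nonneg {d : ℕ} (ρ : Measure (Vec d)) (θs : Vec d) (p : ℕ) :
    0 ≤ centralMoment ρ θs p :=
  integral_nonneg fun _ => by positivity

variable {d : ℕ} {ρ : Measure (Vec d)} [IsProbabilityMeasure ρ] {θs : Vec d} {c : ℝ}

lemma integrable_of_abs_le (hint : Integrable (fun θ => ‖θ - θs‖ ^ 4) ρ) {F : Vec d → ℝ}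
    (hF : Continuous F) (K : ℝ) (h : ∀ θ, |F θ| ≤ K * (1 + ‖θ - θs‖ ^ 4)) : Integrable F ρ :=
  Integrable.mono' (((integrable_const 1).add hint).const_mul K) hF.aestronglyMeasurable
    (Filter.Eventually.of_forall h)

lemma integrable_norm_pow (hint : Integrable (fun θ => ‖θ - θs‖ ^ 4) ρ) {k : ℕ} (hk : k ≤ 4) :
    Integrable (fun θ => ‖θ - θs‖ ^ k) ρ := by
  refine integrable_of_abs_le hint (by fun_prop) 1 fun θ => ?_
  rw [abs_of_nonneg (by positivity), one_mul]
  rcases le_total ‖θ - θs‖ 1 with h | h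
  · have := pow_le_one₀ (n := k) (norm_nonneg _) h
    have : 0 ≤ ‖θ - θs‖ ^ 4 := by positivity
    linarith
  · have := pow_le_pow_right₀ h hk
    linarith

/-- A continuous function of at most quadratic growth is integrable. -/
lemma integrable_of_quadratic_growth (hint : Integrable (fun θ => ‖θ - θs‖ ^ 4) ρ)
    {F : Vec d → ℝ} (hF : Continuous F) (a b : ℝ) (h : ∀ θ, |F θ| ≤ a + b * ‖θ - θs‖ ^ 2) :
    Integrable F ρ :=
  Integrable.mono' ((integrable_const a).add ((integrable_norm_pow hint (k := 2)
    (by norm_num)).const_mul b)) hF.aestronglyMeasurable (Filter.Eventually.of_forall h)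

lemma norm_sq_le_two_mul (θ θs : Vec d) : ‖θ‖ ^ 2 ≤ 2 * ‖θs‖ ^ 2 + 2 * ‖θ - θs‖ ^ 2 := by
  have h : ‖θ‖ ≤ ‖θ - θs‖ + ‖θs‖ := by simpa using norm_add_le (θ - θs) θs
  have h2 : ‖θ‖ ^ 2 ≤ (‖θ - θs‖ + ‖θs‖) ^ 2 := by gcongr
  nlinarith [sq_nonneg (‖θ - θs‖ - ‖θs‖)]

lemma integrable_coord (hint : Integrable (fun θ => ‖θ - θs‖ ^ 4) ρ) (i : Fin d) :
    Integrable (fun θ : Vec d => θ i) ρ := by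
  refine integrable_of_quadratic_growth hint (by fun_prop) (1 + 2 * ‖θs‖ ^ 2) 2 fun θ => ?_
  have h1 := abs_apply_le_norm θ i
  have h2 := norm_sq_le_two_mul θ θs
  nlinarith [sq_nonneg (‖θ‖ - 1), sq_nonneg ‖θ‖]

lemma integrable_coord_mul (hint : Integrable (fun θ => ‖θ - θs‖ ^ 4) ρ) (i j : Fin d) :
    Integrable (fun θ : Vec d => θ i * θ j) ρ := by
  refine integrable_of_quadratic_growth hint (by fun_prop) (2 * ‖θs‖ ^ 2) 2 fun θ => ?_
  have h1 := abs_apply_le_norm θ i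
  have h1' := abs_apply_le_norm θ j
  have h2 := norm_sq_le_two_mul θ θs
  rw [abs_mul]
  have := mul_le_mul h1 h1' (abs_nonneg _) (norm_nonneg _)
  linarith

lemma inner_eq_sum (w θ : Vec d) : inner ℝ w θ = ∑ i, w i * θ i := by
  rw [inner_eq_dotProduct]; rfl

lemma sq_inner_eq_sum (w θ : Vec d) :
    inner ℝ w θ ^ 2 = ∑ i, ∑ j, w i * w j * (θ i * θ j) := by
  rw [inner_eq_sum, sq, Finset.sum_mul_sum]
  exact Finset.sum_congr rfl fun i _ => Finset.sum_congr rfl fun j _ => by ring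

lemma integral_inner (hρ : MeanZeroIsotropic ρ c)
    (hint : Integrable (fun θ => ‖θ - θs‖ ^ 4) ρ) (w : Vec d) :
    Integrable (fun θ => inner ℝ w θ) ρ ∧ ∫ θ, inner ℝ w θ ∂ρ = 0 := by
  have hi : ∀ i, Integrable (fun θ : Vec d => w i * θ i) ρ :=
    fun i => (integrable_coord hint i).const_mul _
  simp only [inner_eq_sum]
  refine ⟨integrable_finsetSum _ fun i _ => hi i, ?_⟩
  rw [integral_finsetSum _ fun i _ => hi i]
  simp [integral_const_mul, hρ.mean_zero]

lemma integral_sq_inner (hρ : MeanZeroIsotropic ρ c)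
    (hint : Integrable (fun θ => ‖θ - θs‖ ^ 4) ρ) (w : Vec d) :
    Integrable (fun θ => inner ℝ w θ ^ 2) ρ ∧ ∫ θ, inner ℝ w θ ^ 2 ∂ρ = c ^ 2 * ‖w‖ ^ 2 := by
  have hi : ∀ i j, Integrable (fun θ : Vec d => w i * w j * (θ i * θ j)) ρ :=
    fun i j => (integrable_coord_mul hint i j).const_mul _
  simp only [sq_inner_eq_sum]
  refine ⟨integrable_finsetSum _ fun i _ => integrable_finsetSum _ fun j _ => hi i j, ?_⟩
  rw [integral_finsetSum _ fun i _ => integrable_finsetSum _ fun j _ => hi i j]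
  simp_rw [integral_finsetSum _ fun j _ => hi _ j, integral_const_mul, hρ.second_moment]
  rw [EuclideanSpace.norm_sq_eq, Finset.mul_sum]
  refine Finset.sum_congr rfl fun i _ => ?_
  simp only [mul_ite, mul_zero, Finset.sum_ite_eq, Finset.mem_univ, if_true, Real.norm_eq_abs,
    sq_abs]
  ring

/-- The second moment of `θ - θs` in the direction `w`. -/
lemma integral_sq_inner_sub (hρ : MeanZeroIsotropic ρ c)
    (hint : Integrable (fun θ => ‖θ - θs‖ ^ 4) ρ) (w : Vec d) :
    Integrable (fun θ => inner ℝ w (θ - θs) ^ 2) ρ ∧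
      ∫ θ, inner ℝ w (θ - θs) ^ 2 ∂ρ = c ^ 2 * ‖w‖ ^ 2 + inner ℝ w θs ^ 2 := by
  obtain ⟨i1, e1⟩ := integral_inner hρ hint w
  obtain ⟨i2, e2⟩ := integral_sq_inner hρ hint w
  have e : ∀ θ, inner ℝ w (θ - θs) ^ 2 =
      inner ℝ w θ ^ 2 - 2 * inner ℝ w θs * inner ℝ w θ + inner ℝ w θs ^ 2 := by
    intro θ
    rw [inner_sub_right]
    ring
  simp only [e]
  have i3 : Integrable (fun θ => inner ℝ w θ ^ 2 - 2 * inner ℝ w θs * inner ℝ w θ) ρ :=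
    i2.sub (i1.const_mul _)
  refine ⟨i3.add (integrable_const _), ?_⟩
  rw [integral_add i3 (integrable_const _), integral_sub i2 (i1.const_mul _),
    integral_const_mul, e1, e2]
  simp

/-- The variance `c²` in one coordinate direction forces this: `r² ≤ c² / 2 + r⁴ / (2 c²)`
integrates to `M₄ ≥ c⁴`. The second threshold divides by `M₄`. -/
lemma centralMoment_four_pos [NeZero d] (hρ : MeanZeroIsotropic ρ c)
    (hint : Integrable (fun θ => ‖θ - θs‖ ^ 4) ρ) (hc : 0 < c) : 0 < centralMoment ρ θs 4 := by
  obtain ⟨i, e⟩ := integral_sq_inner_sub hρ hint (EuclideanSpace.single 0 1)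
  have hle : ∫ θ, inner ℝ (EuclideanSpace.single (0 : Fin d) (1 : ℝ)) (θ - θs) ^ 2 ∂ρ ≤
      ∫ θ, (c ^ 2 / 2 + 1 / (2 * c ^ 2) * ‖θ - θs‖ ^ 4) ∂ρ := by
    refine integral_mono i ((integrable_const _).add (hint.const_mul _)) fun θ => ?_
    have h1 : |inner ℝ (EuclideanSpace.single (0 : Fin d) (1 : ℝ)) (θ - θs)| ≤ ‖θ - θs‖ := by
      simpa using abs_real_inner_le_norm (EuclideanSpace.single (0 : Fin d) (1 : ℝ)) (θ - θs)
    have h2 := pow_le_pow_left₀ (abs_nonneg _) h1 2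
    rw [sq_abs] at h2
    refine h2.trans ?_
    have h3 : c ^ 2 / 2 + 1 / (2 * c ^ 2) * ‖θ - θs‖ ^ 4 - ‖θ - θs‖ ^ 2 =
        (c ^ 2 - ‖θ - θs‖ ^ 2) ^ 2 / (2 * c ^ 2) := by
      field_simp
      ring
    have h4 : 0 ≤ (c ^ 2 - ‖θ - θs‖ ^ 2) ^ 2 / (2 * c ^ 2) := by positivity
    linarith
  rw [e, integral_add (integrable_const _) (hint.const_mul _), integral_const_mul] at hle
  simp only [PiLp.norm_single, norm_one, integral_const, probReal_univ, one_smul] at hle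
  have h0 : 0 < 1 / (2 * c ^ 2) * centralMoment ρ θs 4 := by
    have : 0 < c ^ 2 := by positivity
    have := sq_nonneg (inner ℝ (EuclideanSpace.single (0 : Fin d) (1 : ℝ)) θs)
    unfold centralMoment
    linarith
  exact pos_of_mul_pos_right h0 (by positivity)

variable {f : Vec d → ℝ} {L : Fin d → ℝ} {H : ℝ}

lemma CoordSmooth.norm_gradient_le (hL : CoordSmooth f L) (hmin : IsLocalMin f θs) (θ : Vec d) :
    ‖gradient f θ‖ ≤ 3 * (∑ i, L i) * ‖θ - θs‖ := by
  have h := hL.norm_gradient_sub_le θs θ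
  rwa [gradient_eq_zero_of_isLocalMin hmin, sub_zero] at h

/-- The quadratic form of the EGOP is the second moment of the directional derivative. -/
lemma dotProduct_egop (hf : TwiceDifferentiable f) (hL : CoordSmooth f L)
    (hmin : IsLocalMin f θs) (hint : Integrable (fun θ => ‖θ - θs‖ ^ 4) ρ) (w : Vec d) :
    Integrable (fun θ => inner ℝ w (gradient f θ) ^ 2) ρ ∧
      ∫ θ, inner ℝ w (gradient f θ) ^ 2 ∂ρ = w.ofLp ⬝ᵥ (egop ρ f).mulVec w.ofLp := by
  have hcont : Continuous (gradient f) := hf.2.continuous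
  have hij : ∀ i j, Integrable (fun θ => gradient f θ i * gradient f θ j) ρ := by
    intro i j
    refine integrable_of_quadratic_growth hint (by fun_prop) 0 ((3 * ∑ i, L i) ^ 2) fun θ => ?_
    have h := hL.norm_gradient_le hmin θ
    rw [abs_mul]
    calc _ ≤ ‖gradient f θ‖ * ‖gradient f θ‖ :=
          mul_le_mul (abs_apply_le_norm _ i) (abs_apply_le_norm _ j) (abs_nonneg _) (norm_nonneg _)
      _ ≤ (3 * (∑ i, L i) * ‖θ - θs‖) * (3 * (∑ i, L i) * ‖θ - θs‖) :=
          mul_le_mul h h (norm_nonneg _) ((norm_nonneg _).trans h)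
      _ = _ := by ring
  have hi : ∀ i j, Integrable (fun θ => w i * w j * (gradient f θ i * gradient f θ j)) ρ :=
    fun i j => (hij i j).const_mul _
  simp only [sq_inner_eq_sum]
  refine ⟨integrable_finsetSum _ fun i _ => integrable_finsetSum _ fun j _ => hi i j, ?_⟩
  rw [integral_finsetSum _ fun i _ => integrable_finsetSum _ fun j _ => hi i j]
  simp_rw [integral_finsetSum _ fun j _ => hi _ j, integral_const_mul, dotProduct, Matrix.mulVec,
    dotProduct, Finset.mul_sum, egop, Matrix.of_apply]
  exact Finset.sum_congr rfl fun i _ => Finset.sum_congr rfl fun j _ => by ring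

/-- Lower and upper bounds of the EGOP quadratic form through the Hessian at the minimum. -/
lemma egop_quadratic_bounds (hf : TwiceDifferentiable f) (hL : CoordSmooth f L)
    (hH : HessianLipschitz f H) (hH0 : 0 ≤ H)
    (hmin : IsLocalMin f θs) (hρ : MeanZeroIsotropic ρ c)
    (hint : Integrable (fun θ => ‖θ - θs‖ ^ 4) ρ) (hc : ‖θs‖ ≤ c) (w : Vec d) :
    c ^ 2 * ‖hessian f θs w‖ ^ 2 -
        2 * (‖hessian f θs w‖ * ‖w‖ * (H * centralMoment ρ θs 3)) ≤
      w.ofLp ⬝ᵥ (egop ρ f).mulVec w.ofLp ∧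
    w.ofLp ⬝ᵥ (egop ρ f).mulVec w.ofLp ≤ 4 * c ^ 2 * ‖hessian f θs w‖ ^ 2 +
        2 * ‖w‖ ^ 2 * (H ^ 2 * centralMoment ρ θs 4) := by
  obtain ⟨i1, e1⟩ := dotProduct_egop hf hL hmin hint w
  set a := hessian f θs w with ha
  obtain ⟨i2, e2⟩ := integral_sq_inner_sub hρ hint a
  have i3 := integrable_norm_pow hint (k := 3) (by norm_num)
  have hsplit : ∀ θ, ∃ s, inner ℝ w (gradient f θ) = inner ℝ a (θ - θs) + s ∧
      |s| ≤ ‖w‖ * (H * ‖θ - θs‖ ^ 2) := by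
    intro θ
    refine ⟨inner ℝ w (gradient f θ - hessian f θs (θ - θs)), ?_, ?_⟩
    · have h := hf.isSymmetric_hessian θs w (θ - θs)
      simp only [ContinuousLinearMap.coe_coe] at h
      rw [ha, h, inner_sub_right]
      ring
    · refine (abs_real_inner_le_norm _ _).trans ?_
      gcongr
      exact norm_gradient_sub_hessian_le hf hH hH0 hmin θ
  rw [← e1]
  -- The mean of `θ - θs` adds this term to the variance; `‖θs‖ ≤ c` makes it at most the variance,
  -- whence `4 c²` in the upper bound.
  have hin : inner ℝ a θs ^ 2 ≤ c ^ 2 * ‖a‖ ^ 2 := by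
    rw [← sq_abs, ← mul_pow]
    gcongr
    refine (abs_real_inner_le_norm _ _).trans ?_
    rw [mul_comm]
    gcongr
  constructor
  · have : ∫ θ, (inner ℝ a (θ - θs) ^ 2 - 2 * ‖a‖ * ‖w‖ * H * ‖θ - θs‖ ^ 3) ∂ρ ≤
        ∫ θ, inner ℝ w (gradient f θ) ^ 2 ∂ρ := by
      refine integral_mono (i2.sub (i3.const_mul _)) i1 fun θ => ?_
      obtain ⟨s, hs, hs'⟩ := hsplit θ
      have h1 := abs_real_inner_le_norm a (θ - θs)
      have h2 := mul_le_mul h1 hs' (abs_nonneg _) (by positivity)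
      rw [← abs_mul] at h2
      have h3 := (abs_le.1 h2).1
      simp only [hs]
      nlinarith [sq_nonneg s]
    rw [integral_sub i2 (i3.const_mul _), integral_const_mul, e2] at this
    unfold centralMoment
    nlinarith [sq_nonneg (inner ℝ a θs)]
  · have : ∫ θ, inner ℝ w (gradient f θ) ^ 2 ∂ρ ≤
        ∫ θ, (2 * inner ℝ a (θ - θs) ^ 2 + 2 * ‖w‖ ^ 2 * H ^ 2 * ‖θ - θs‖ ^ 4) ∂ρ := by
      refine integral_mono i1 ((i2.const_mul _).add (hint.const_mul _)) fun θ => ?_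
      obtain ⟨s, hs, hs'⟩ := hsplit θ
      have h2 := pow_le_pow_left₀ (abs_nonneg _) hs' 2
      rw [sq_abs] at h2
      simp only [hs]
      nlinarith [sq_nonneg (inner ℝ a (θ - θs) - s)]
    rw [integral_add (i2.const_mul _) (hint.const_mul _), integral_const_mul,
      integral_const_mul, e2] at this
    unfold centralMoment
    nlinarith

end Moments

/-! ### The smallness conditions -/

/-- The bound on `H` says that `H r` lies below the positive root of the quadratic `M₄ X² + 2 M₃
lamH X - ζ c² lamH²`. It is used with `r = √d`. -/
lemma mul_sqrt_sub_le_sq {H lamH c M₃ M₄ ζ r : ℝ} (hH0 : 0 ≤ H) (hl : 0 ≤ lamH) (hr : 0 < r)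
    (h3 : 0 ≤ M₃) (h4 : 0 < M₄) (hζ : 0 ≤ ζ)
    (h : H ≤ lamH / (M₄ * r) * (√(M₃ ^ 2 + ζ * c ^ 2 * M₄) - M₃)) :
    H ^ 2 * r ^ 2 * M₄ + 2 * H * r * M₃ * lamH ≤ ζ * c ^ 2 * lamH ^ 2 := by
  set S := √(M₃ ^ 2 + ζ * c ^ 2 * M₄) with hS
  have hS2 : S ^ 2 = M₃ ^ 2 + ζ * c ^ 2 * M₄ := Real.sq_sqrt (by positivity)
  have h1 : H * (M₄ * r) + lamH * M₃ ≤ lamH * S := by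
    rw [div_mul_eq_mul_div, le_div_iff₀ (by positivity)] at h
    linarith
  have h2 := pow_le_pow_left₀ (by positivity) h1 2
  have h5 : M₄ * (H ^ 2 * r ^ 2 * M₄ + 2 * H * r * M₃ * lamH) ≤ M₄ * (ζ * c ^ 2 * lamH ^ 2) := by
    rw [mul_pow lamH S, hS2] at h2
    linarith
  exact le_of_mul_le_mul_left h5 h4

lemma threshold₂_consequences {d : ℕ} [NeZero d] {H lamH c M₃ M₄ δ : ℝ} (hH0 : 0 ≤ H)
    (hl : 0 ≤ lamH) (h3 : 0 ≤ M₃) (h4 : 0 < M₄) (hδ : 0 < δ)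
    (h : H ≤ threshold₂ d lamH c M₃ M₄ δ) :
    2 * (H * M₃) ≤ δ / (1 + δ) * c ^ 2 * lamH ∧
      d * (H ^ 2 * M₄) ≤ δ / (1 + δ) * c ^ 2 * lamH ^ 2 := by
  have hd : (1 : ℝ) ≤ d := by exact_mod_cast NeZero.one_le
  have hr : 1 ≤ √(d : ℝ) := Real.one_le_sqrt.2 hd
  have hζ : 0 ≤ δ / (1 + δ) := by positivity
  have key := mul_sqrt_sub_le_sq hH0 hl (by positivity) h3 h4 hζ h
  rw [Real.sq_sqrt (by positivity)] at key
  have hp : 0 ≤ 2 * H * √(d : ℝ) * M₃ * lamH := by positivity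
  have hq : 0 ≤ H ^ 2 * d * M₄ := by positivity
  refine ⟨?_, by linarith⟩
  rcases hl.eq_or_lt with h0 | h0
  · have : H = 0 := by
      refine le_antisymm (h.trans_eq ?_) hH0
      rw [threshold₂, ← h0]
      simp
    simp [this, ← h0]
  · have h1 : (2 * H * √(d : ℝ) * M₃) * lamH ≤ (δ / (1 + δ) * c ^ 2 * lamH) * lamH := by linarith
    refine le_trans ?_ (le_of_mul_le_mul_right h1 h0)
    have : H * M₃ * 1 ≤ H * M₃ * √(d : ℝ) := by gcongr
    linarith

/-- Clearing denominators gives `δ (4 - ε²) ≤ β ε √(1 - ε²)`, with `4 - ε² ≥ 3`. The right side is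
at most `β ε`, and also at most `β / 2` because `ε √(1 - ε²) ≤ 1 / 2`. -/
lemma zeta_consequences {β δ ε : ℝ} (hβ : 0 < β) (hδ : 0 < δ) (hε : 0 < ε) (hε1 : ε < 1)
    (h : δ / (1 + δ) ≤ β * ε * √(1 - ε ^ 2) / (β * ε * √(1 - ε ^ 2) + 4 - ε ^ 2)) :
    δ ≤ β * ε / 3 ∧ δ ≤ β / 6 ∧ δ < β := by
  have hs2 : √(1 - ε ^ 2) ^ 2 = 1 - ε ^ 2 := Real.sq_sqrt (by nlinarith)
  set s := √(1 - ε ^ 2) with hs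
  have hs0 : 0 ≤ s := Real.sqrt_nonneg _
  have hs1 : s ≤ 1 := by nlinarith
  have hx : 0 ≤ β * ε * s := by positivity
  rw [div_le_div_iff₀ (by positivity) (by nlinarith)] at h
  have h1 : 3 * δ ≤ β * ε * s := by nlinarith
  have h2 : β * ε * s ≤ β * ε := mul_le_of_le_one_right (by positivity) hs1
  have h3 : β * (ε * s) ≤ β * (1 / 2) :=
    mul_le_mul_of_nonneg_left (by nlinarith [sq_nonneg (ε - s)]) hβ.le
  refine ⟨by linarith, by linarith, by linarith⟩

/-! ### Comparing the Hessian at the minimum with the EGOP eigenvalues -/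

section Spectral

variable {d : ℕ} {V P : Matrix (Fin d) (Fin d) ℝ} {lam : Fin d → ℝ}

lemma sum_sq_column (hV : V ∈ Matrix.orthogonalGroup (Fin d) ℝ) (j : Fin d) :
    ∑ i, V i j ^ 2 = 1 := by
  have h := norm_apply hV (EuclideanSpace.single j 1)
  have h2 : ‖apply V (EuclideanSpace.single j 1)‖ ^ 2 = 1 := by rw [h]; simp
  rw [EuclideanSpace.norm_sq_eq] at h2
  simpa [apply] using h2

lemma IsEigendecomposition.dotProduct (h : IsEigendecomposition P V lam) (w : Vec d) :
    w.ofLp ⬝ᵥ P.mulVec w.ofLp = ∑ k, lam k * apply V.transpose w k ^ 2 := by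
  rw [h.eq, dotProduct_eigendecomposition]

lemma IsEigendecomposition.dotProduct_column (h : IsEigendecomposition P V lam) (k : Fin d) :
    (apply V (EuclideanSpace.single k 1)).ofLp ⬝ᵥ
      P.mulVec (apply V (EuclideanSpace.single k 1)).ofLp = lam k := by
  rw [h.dotProduct, apply_transpose_apply h.orthogonal]
  simp

variable [NeZero d]

lemma density_pos (hV : V ∈ Matrix.orthogonalGroup (Fin d) ℝ) : 0 < density V := by
  have hd : (0 : ℝ) < d := by exact_mod_cast NeZero.pos d
  have h0 : 0 < ∑ i, |V i 0| := by
    refine (Finset.sum_nonneg fun i _ => abs_nonneg (V i 0)).lt_of_ne fun h => ?_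
    have hz := (Finset.sum_eq_zero_iff_of_nonneg fun i _ => abs_nonneg (V i 0)).1 h.symm
    have h1 := sum_sq_column hV 0
    rw [Finset.sum_eq_zero fun i hi => by rw [abs_eq_zero.1 (hz i hi)]; simp] at h1
    exact zero_ne_one h1
  unfold density
  positivity

lemma density_le_one (hV : V ∈ Matrix.orthogonalGroup (Fin d) ℝ) : density V ≤ 1 := by
  have hd : (0 : ℝ) < d := by exact_mod_cast NeZero.pos d
  rw [density, div_le_one hd]
  have h := sq_sum_le_card_mul_sum_sq (s := Finset.univ) (f := fun i => |V i 0|)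
  simp only [sq_abs, sum_sq_column hV, Finset.card_univ, Fintype.card_fin, mul_one] at h
  exact h

lemma IsEigendecomposition.dotProduct_le (h : IsEigendecomposition P V lam) (w : Vec d) :
    w.ofLp ⬝ᵥ P.mulVec w.ofLp ≤ lam 0 * ‖w‖ ^ 2 := by
  rw [h.dotProduct, ← norm_apply_transpose h.orthogonal w, EuclideanSpace.norm_sq_eq,
    Finset.mul_sum]
  refine Finset.sum_le_sum fun k _ => ?_
  rw [Real.norm_eq_abs, sq_abs]
  exact mul_le_mul_of_nonneg_right (h.antitone (Fin.zero_le k)) (sq_nonneg _)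

/-- Testing `P` against the sign vector of the leading eigenvector. -/
lemma IsEigendecomposition.exists_sign_vector (h : IsEigendecomposition P V lam)
    (hlam : ∀ k, 0 ≤ lam k) :
    ∃ s : Vec d, (∀ i, s i ^ 2 = 1) ∧ ‖s‖ ^ 2 = d ∧
      lam 0 * (density V * d) ≤ s.ofLp ⬝ᵥ P.mulVec s.ofLp := by
  have hd : (0 : ℝ) < d := by exact_mod_cast NeZero.pos d
  let s : Vec d := WithLp.toLp 2 fun i => if 0 ≤ V i 0 then 1 else -1
  have hs : ∀ i, s i ^ 2 = 1 := by
    intro i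
    simp only [s]
    split_ifs <;> norm_num
  refine ⟨s, hs, ?_, ?_⟩
  · rw [EuclideanSpace.norm_sq_eq]
    simp [hs]
  · have h0 : apply V.transpose s 0 = ∑ i, |V i 0| := by
      simp only [apply, Matrix.mulVec, _root_.dotProduct, Matrix.transpose_apply, s]
      refine Finset.sum_congr rfl fun i _ => ?_
      split_ifs with hi
      · rw [abs_of_nonneg hi, mul_one]
      · rw [abs_of_neg (not_le.1 hi), mul_neg, mul_one]
    rw [h.dotProduct, density, div_mul_cancel₀ _ hd.ne', ← h0]
    exact Finset.single_le_sum (f := fun k => lam k * apply V.transpose s k ^ 2)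
      (fun k _ => mul_nonneg (hlam k) (sq_nonneg _)) (Finset.mem_univ 0)

/-- The inequality covers the degenerate case: if `√(lam 0) = 0` then division by zero makes the
stable rank `0`, and every `√(lam k)` vanishes too. -/
lemma sum_sqrt_le_stableRank_mul (hlam : Antitone lam) :
    ∑ k, √(lam k) ≤ stableRank lam * √(lam 0) := by
  rcases eq_or_ne (√(lam 0)) 0 with h0 | h0
  · rw [h0, mul_zero]
    refine Finset.sum_nonpos fun k _ => ?_
    rw [← h0]
    exact Real.sqrt_le_sqrt (hlam (Fin.zero_le k))
  · rw [stableRank, div_mul_cancel₀ _ h0]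

lemma stableRank_nonneg : 0 ≤ stableRank lam :=
  div_nonneg (Finset.sum_nonneg fun _ _ => Real.sqrt_nonneg _) (Real.sqrt_nonneg _)

variable {ρ : Measure (Vec d)} [IsProbabilityMeasure ρ] {θs : Vec d} {c : ℝ}
  {f : Vec d → ℝ} {L : Fin d → ℝ} {H : ℝ}

set_option maxHeartbeats 800000 in
/-- The diagonal majorant, in the EGOP eigenbasis, of the Hessian at the local minimum. -/
lemma exists_diagonal_majorant (hf : TwiceDifferentiable f) (hL : CoordSmooth f L)
    (hH : HessianLipschitz f H) (hmin : IsLocalMin f θs)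
    (hρ : MeanZeroIsotropic ρ c) (hint : Integrable (fun θ => ‖θ - θs‖ ^ 4) ρ)
    (hc0 : 0 < c) (hc : ‖θs‖ ≤ c) (hV : IsEigendecomposition (egop ρ f) V lam)
    {δ ε : ℝ} (hδ : 0 < δ) (hε : 0 ≤ ε) (hδε : δ ≤ density V * ε / 3) (hδβ : δ ≤ density V / 6)
    (hT : H ≤ threshold₂ d (lambdaMax (hessian f θs)) c (centralMoment ρ θs 3)
      (centralMoment ρ θs 4) δ) :
    lambdaMax (hessian f θs) * density V * d ≤ 8 * ∑ i, L i ∧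
    ∃ D : Fin d → ℝ, (∀ k, 0 ≤ D k) ∧
      (∀ x, inner ℝ (hessian f θs x) x ≤ ∑ k, D k * apply V.transpose x k ^ 2) ∧
      ∑ k, D k ≤ 40 * ((1 / (density V - δ) * (stableRank lam / d) + ε) * ∑ i, L i) := by
  have hd : (1 : ℝ) ≤ d := by exact_mod_cast NeZero.one_le
  have hH0 := hH.nonneg
  have hsymm := hf.isSymmetric_hessian θs
  have hpos := inner_hessian_nonneg hf hH hH0 hmin
  have hl0 := lambdaMax_nonneg hsymm hpos
  have hβ := density_pos hV.orthogonal
  have hβ1 := density_le_one hV.orthogonal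
  obtain ⟨hM3, hM4⟩ := threshold₂_consequences hH0 hl0 (centralMoment_nonneg ρ θs 3)
    (centralMoment_four_pos hρ hint hc0) hδ hT
  have hbounds := egop_quadratic_bounds hf hL hH hH0 hmin hρ hint hc
  have hMpos := centralMoment_nonneg ρ θs 4
  set A := hessian f θs with hA
  set μ := lambdaMax A with hμ
  set β := density V with hβdef
  set ζ := δ / (1 + δ) with hζdef
  have hζ0 : 0 ≤ ζ := by positivity
  have hζδ : ζ ≤ δ := div_le_self hδ.le (by linarith)
  have hlam : ∀ k, 0 ≤ lam k := by
    intro k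
    rw [← hV.dotProduct_column k, ← (dotProduct_egop hf hL hmin hint _).2]
    exact integral_nonneg fun _ => sq_nonneg _
  have hM4' : H ^ 2 * centralMoment ρ θs 4 ≤ ζ * c ^ 2 * μ ^ 2 := by
    refine le_trans ?_ hM4
    exact le_mul_of_one_le_left (by positivity) hd
  have hc2 : 0 < c ^ 2 := by positivity
  have hlower : ∀ w, c ^ 2 * (‖A w‖ ^ 2 - ‖A w‖ * ‖w‖ * (ζ * μ)) ≤
      w.ofLp ⬝ᵥ (egop ρ f).mulVec w.ofLp := by
    intro w
    refine le_trans ?_ (hbounds w).1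
    have := mul_le_mul_of_nonneg_left hM3 (mul_nonneg (norm_nonneg (A w)) (norm_nonneg w))
    linarith
  -- Test the EGOP against a unit top eigenvector of the Hessian.
  have hlam_lower : c ^ 2 * (μ ^ 2 * (1 - ζ)) ≤ lam 0 := by
    obtain ⟨u, hu, hAu⟩ := (exists_unit_eigenvector_lambdaMax hsymm).1
    have h1 := (hlower u).trans (hV.dotProduct_le u)
    have h2 : ‖A u‖ = μ := by
      rw [hAu, norm_smul, hu, mul_one, Real.norm_eq_abs, abs_of_nonneg hl0]
    rw [h2, hu] at h1
    linarith
  have hlam_upper : lam 0 ≤ 5 * c ^ 2 * μ ^ 2 := by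
    have h1 := (hbounds (apply V (EuclideanSpace.single 0 1))).2
    rw [hV.dotProduct_column 0] at h1
    have hn : ‖apply V (EuclideanSpace.single (0 : Fin d) (1 : ℝ))‖ = 1 := by
      rw [norm_apply hV.orthogonal]; simp
    have h2 := pow_le_pow_left₀ (norm_nonneg _)
      (norm_le_lambdaMax_mul hsymm hpos (apply V (EuclideanSpace.single (0 : Fin d) (1 : ℝ)))) 2
    rw [hn, mul_one] at h2
    rw [hn] at h1
    have h3 := mul_le_mul_of_nonneg_left h2 hc2.le
    have h4 : ζ * (c ^ 2 * μ ^ 2) ≤ 1 / 2 * (c ^ 2 * μ ^ 2) := by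
      gcongr
      linarith
    linarith
  -- The sign vector has unit squared entries, so its Hessian form is at most `∑ L i`. The errors
  -- consume `1 / 6 + 1 / 3` of `μ β d`, and the remaining half turns the constant `4` into `8`.
  have hLf : μ * β * d ≤ 8 * ∑ i, L i := by
    obtain ⟨s, hs1, hs2, hs3⟩ := hV.exists_sign_vector hlam
    have h1 := hs3.trans (hbounds s).2
    have h2 := inner_hessian_le_sum hf hH hH0 hmin hL s
    simp only [hs1, mul_one] at h2
    have h3 := (sq_norm_le_of_nonneg hsymm hpos s).trans (mul_le_mul_of_nonneg_left h2 hl0)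
    rw [hs2] at h1
    rcases hl0.eq_or_lt with h0 | h0
    · rw [← h0, zero_mul, zero_mul]
      have := Finset.sum_nonneg fun i (_ : i ∈ Finset.univ) => (hL.1 i).le
      linarith
    have h4 := mul_le_mul_of_nonneg_left h3 hc2.le
    have h5 := mul_le_mul_of_nonneg_right hlam_lower (mul_nonneg hβ.le (by linarith : (0 : ℝ) ≤ d))
    have h6 : (c ^ 2 * μ) * (μ * (1 - ζ) * (β * d)) ≤
        (c ^ 2 * μ) * (4 * (∑ i, L i) + 2 * ζ * μ) := by linarith
    have h7 := le_of_mul_le_mul_left h6 (by positivity)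
    have h8 : ζ ≤ β * d / 6 := by nlinarith
    have h9 : ζ * (μ * (β * d)) ≤ 1 / 6 * (μ * (β * d)) := by
      gcongr
      linarith
    have h10 : ζ * μ ≤ β * d / 6 * μ := by gcongr
    linarith
  -- The squares of these entries dominate `(2 / c²) lam k + (ζ μ)²`, which is what the lower EGOP
  -- bound gives for `A²` once the mixed term `‖A y‖ ‖y‖ ζ μ` is split by AM–GM.
  refine ⟨hLf, fun k => 2 * √(lam k) / c + ζ * μ, fun k => by positivity, ?_, ?_⟩
  · obtain ⟨hDs, hDq, hDn⟩ := diagonal_operator hV.orthogonal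
      (fun k => 2 * √(lam k) / c + ζ * μ)
    intro x
    rw [← hDq]
    refine inner_le_inner_of_norm_le hsymm hDs (fun y => ?_) (fun y => ?_) x
    · rw [hDq]
      exact Finset.sum_nonneg fun k _ => mul_nonneg (by positivity) (sq_nonneg _)
    · rw [hDn]
      have h1 := hlower y
      rw [hV.dotProduct] at h1
      have h2 : ‖A y‖ ^ 2 ≤ ∑ k, (2 / c ^ 2 * lam k + (ζ * μ) ^ 2) *
          apply V.transpose y k ^ 2 := by
        simp only [add_mul, Finset.sum_add_distrib, mul_assoc, ← Finset.mul_sum]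
        have hn : ∑ k, apply V.transpose y k ^ 2 = ‖y‖ ^ 2 := by
          rw [← norm_apply_transpose hV.orthogonal y, EuclideanSpace.norm_sq_eq]
          simp
        rw [hn]
        have h3 : ‖A y‖ ^ 2 - ‖A y‖ * ‖y‖ * (ζ * μ) ≤
            1 / c ^ 2 * ∑ k, lam k * apply V.transpose y k ^ 2 := by
          rw [one_div, ← div_eq_inv_mul, le_div_iff₀ hc2]
          linarith
        have h4 := sq_nonneg (‖A y‖ - ‖y‖ * (ζ * μ))
        have e : 2 / c ^ 2 = 2 * (1 / c ^ 2) := by ring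
        rw [e]
        nlinarith
      refine h2.trans (Finset.sum_le_sum fun k _ => mul_le_mul_of_nonneg_right ?_ (sq_nonneg _))
      have h3 : (2 * √(lam k) / c) ^ 2 = 4 / c ^ 2 * lam k := by
        rw [div_pow, mul_pow, Real.sq_sqrt (hlam k)]
        ring
      have h4 : 2 / c ^ 2 * lam k ≤ 4 / c ^ 2 * lam k := by
        have := hlam k
        gcongr
        norm_num
      have h5 : 0 ≤ 2 * √(lam k) / c * (ζ * μ) := by positivity
      rw [add_sq, h3]
      linarith
  · have hsr := sum_sqrt_le_stableRank_mul hV.antitone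
    have hsr0 : 0 ≤ stableRank lam := stableRank_nonneg
    have h1 : √(lam 0) ≤ 5 / 2 * c * μ := by
      refine Real.sqrt_le_iff.2 ⟨by positivity, hlam_upper.trans ?_⟩
      nlinarith [mul_nonneg hc2.le (sq_nonneg μ)]
    have h2 : ∑ k, (2 * √(lam k) / c + ζ * μ) = 2 / c * ∑ k, √(lam k) + d * (ζ * μ) := by
      rw [Finset.sum_add_distrib, Finset.mul_sum]
      congr 1
      · exact Finset.sum_congr rfl fun k _ => by ring
      · simp
    have h3 : 2 / c * ∑ k, √(lam k) ≤ 5 * (stableRank lam * μ) := by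
      calc 2 / c * ∑ k, √(lam k) ≤ 2 / c * (stableRank lam * (5 / 2 * c * μ)) := by
            refine mul_le_mul_of_nonneg_left (hsr.trans ?_) (by positivity)
            gcongr
        _ = _ := by field_simp
    have hβδ : 0 < β - δ := by linarith
    have h4 : μ ≤ 8 * ((1 / (β - δ)) * (1 / d) * ∑ i, L i) := by
      have : μ * ((β - δ) * d) ≤ 8 * ∑ i, L i := by
        refine le_trans ?_ hLf
        rw [mul_assoc]
        gcongr
        linarith
      have e : 8 * ((1 / (β - δ)) * (1 / d) * ∑ i, L i) = (8 * ∑ i, L i) / ((β - δ) * d) := by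
        field_simp
      rw [e, le_div_iff₀ (by positivity)]
      exact this
    have h5 := mul_le_mul_of_nonneg_left h4 hsr0
    have h6 : d * (ζ * μ) ≤ ε / 3 * (μ * β * d) := by
      have : ζ ≤ β * ε / 3 := hζδ.trans hδε
      calc d * (ζ * μ) ≤ d * (β * ε / 3 * μ) := by gcongr
        _ = _ := by ring
    have h7 := mul_le_mul_of_nonneg_left hLf (by positivity : 0 ≤ ε / 3)
    have hL0 := Finset.sum_nonneg fun i (_ : i ∈ Finset.univ) => (hL.1 i).le
    have h8 := mul_nonneg hε hL0
    rw [h2]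
    have e : 40 * ((1 / (β - δ) * (stableRank lam / d) + ε) * ∑ i, L i) =
        5 * (stableRank lam * (8 * ((1 / (β - δ)) * (1 / d) * ∑ i, L i))) +
          40 * (ε * ∑ i, L i) := by ring
    rw [e]
    linarith

end Spectral

/-! ### Average gradient norms -/

section Average

variable {d : ℕ} {η τ : ℝ} {g : Vec d → ℝ} {x₀ : Vec d}

lemma adagradAverage_le_of_sum_le {T : ℕ} (hT : 1 ≤ T) {B : ℝ}
    (h : ∑ t ∈ Finset.range T, l1norm (gradient g (adagrad η τ g x₀ t)) ≤ √(T : ℝ) * B) :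
    adagradAverage η τ g x₀ T ≤ B / √(T : ℝ) := by
  have hT0 : (0 : ℝ) < T := by exact_mod_cast hT
  have hs : 0 < √(T : ℝ) := Real.sqrt_pos.2 hT0
  rw [adagradAverage, one_div, ← div_eq_inv_mul, div_le_div_iff₀ hT0 hs]
  calc _ ≤ √(T : ℝ) * B * √(T : ℝ) := by gcongr
    _ = B * (√(T : ℝ) * √(T : ℝ)) := by ring
    _ = _ := by rw [Real.mul_self_sqrt hT0.le]

lemma norm_adagrad_le_adagradRadius {T : ℕ} {t : ℕ} (ht : t < T) :
    ‖adagrad η τ g x₀ t‖ ≤ adagradRadius η τ g x₀ T :=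
  le_ciSup (f := fun t : Fin T => ‖adagrad η τ g x₀ t‖) (Set.finite_range _).bddAbove ⟨t, ht⟩

end Average

/-! ### Adagrad in the EGOP eigenbasis -/

section Reparam

variable {d : ℕ} {V : Matrix (Fin d) (Fin d) ℝ} {f : Vec d → ℝ} {θs : Vec d} {H R : ℝ}
  {D : Fin d → ℝ}

lemma sum_add_const_mul_sq (D : Fin d → ℝ) (b : ℝ) (u : Vec d) :
    ∑ k, (D k + b) * u k ^ 2 = ∑ k, D k * u k ^ 2 + b * ‖u‖ ^ 2 := by
  simp only [add_mul, Finset.sum_add_distrib, ← Finset.mul_sum]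
  rw [EuclideanSpace.norm_sq_eq]
  simp

lemma descentAt_comp_apply (hV : V ∈ Matrix.orthogonalGroup (Fin d) ℝ)
    (hf : TwiceDifferentiable f) (hH : HessianLipschitz f H) (hH0 : 0 ≤ H)
    (hD : ∀ x, inner ℝ (hessian f θs x) x ≤ ∑ k, D k * apply V.transpose x k ^ 2)
    {x y : Vec d} (hx : ‖apply V x - θs‖ ≤ 2 * R) (hy : ‖apply V y - θs‖ ≤ 2 * R) :
    DescentAt (fun x => f (apply V x)) (fun k => D k + 4 * (H * R)) x y := by
  have h := (abs_le.1 (abs_sub_quadratic_le hf hH hH0 hx hy)).2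
  have h2 := hD (apply V y - apply V x)
  rw [← apply_sub, apply_transpose_apply hV] at h2
  rw [← apply_sub, norm_apply hV] at h
  rw [DescentAt, gradient_comp_apply hf.1, sum_add_const_mul_sq]
  have e : inner ℝ (apply V.transpose (gradient f (apply V x))) (y - x) =
      inner ℝ (gradient f (apply V x)) (apply V (y - x)) := by
    rw [inner_apply_left, Matrix.transpose_transpose]
  rw [e]
  linarith

lemma exists_sign_inner_eq_l1norm (x : Vec d) :
    ∃ σ : Vec d, (∀ i, σ i ^ 2 = 1) ∧ ‖σ‖ = √(d : ℝ) ∧ inner ℝ σ x = l1norm x := by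
  let s : Vec d := WithLp.toLp 2 fun i => if 0 ≤ x i then 1 else -1
  have hs : ∀ i, s i ^ 2 = 1 := by
    intro i
    simp only [s]
    split_ifs <;> norm_num
  refine ⟨s, hs, ?_, ?_⟩
  · rw [EuclideanSpace.norm_eq]
    simp [hs]
  · rw [inner_eq_sum, l1norm]
    refine Finset.sum_congr rfl fun i _ => ?_
    simp only [s]
    split_ifs with hi
    · rw [abs_of_nonneg hi, one_mul]
    · rw [abs_of_neg (not_le.1 hi), neg_mul, one_mul]

/-- Near the local minimum the `ℓ¹` norm of the rotated gradient is controlled by the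
suboptimality, when the step size dominates the radius. -/
lemma l1norm_gradient_le (hV : V ∈ Matrix.orthogonalGroup (Fin d) ℝ)
    (hf : TwiceDifferentiable f) (hH : HessianLipschitz f H) (hH0 : 0 ≤ H)
    (hmin : IsLocalMin f θs)
    (hD : ∀ x, inner ℝ (hessian f θs x) x ≤ ∑ k, D k * apply V.transpose x k ^ 2)
    {η : ℝ} (hη : 0 < η) (hR : R ≤ √(d : ℝ) * η) {x : Vec d} (hx : ‖x - θs‖ ≤ R) :
    l1norm (apply V.transpose (gradient f x)) ≤
      η / 2 * ∑ k, (D k + 4 * (H * R)) + (f x - f θs) / η := by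
  obtain ⟨σ, hσ, hσn, hσx⟩ := exists_sign_inner_eq_l1norm (apply V.transpose (gradient f x))
  rw [← inner_apply_left] at hσx
  set s := apply V σ with hs
  have hsn : ‖s‖ = √(d : ℝ) := by rw [hs, norm_apply hV, hσn]
  set h := x - θs with hh
  set A := hessian f θs with hA
  have hsymm := hf.isSymmetric_hessian θs
  have hpos := inner_hessian_nonneg hf hH hH0 hmin
  have hR0 : 0 ≤ R := (norm_nonneg _).trans hx
  have hHR : 0 ≤ H * R := mul_nonneg hH0 hR0
  have hhη : ‖h‖ ≤ √(d : ℝ) * η := hx.trans hR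
  have hdd : √(d : ℝ) * √(d : ℝ) = d := Real.mul_self_sqrt (by positivity)
  have hAs : inner ℝ (A s) s ≤ ∑ k, D k := by
    have := hD s
    rw [hs, apply_transpose_apply hV] at this
    simpa [hσ] using this
  have hAh : inner ℝ (A h) h ≤ 2 * (f x - f θs) + 2 * (H * R * (d * η ^ 2)) := by
    have h1 := (abs_le.1 (abs_sub_quadratic_le (θ := θs) hf hH hH0 (x := θs) (y := x)
      (by simpa using hR0) hx)).1
    rw [gradient_eq_zero_of_isLocalMin hmin, inner_zero_left] at h1
    have h2 : ‖h‖ ^ 2 ≤ d * η ^ 2 := by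
      calc ‖h‖ ^ 2 ≤ (√(d : ℝ) * η) ^ 2 := by gcongr
        _ = (√(d : ℝ) * √(d : ℝ)) * η ^ 2 := by ring
        _ = _ := by rw [hdd]
    have h3 := mul_le_mul_of_nonneg_left h2 hHR
    linarith
  -- Cauchy–Schwarz for the Hessian form, with AM–GM weighted by `η` to match the two terms of the
  -- Adagrad bound.
  have hcs : inner ℝ (A s) h ≤ η / 2 * inner ℝ (A s) s + inner ℝ (A h) h / (2 * η) := by
    have h1 := sq_inner_le_of_nonneg hsymm hpos s h
    have h2 := hpos s
    have h3 := hpos h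
    have e : η / 2 * inner ℝ (A s) s + inner ℝ (A h) h / (2 * η) =
        (η ^ 2 * inner ℝ (A s) s + inner ℝ (A h) h) / (2 * η) := by
      field_simp
    rw [e, le_div_iff₀ (by positivity)]
    refine le_of_sq_le_sq ?_ (by positivity)
    have h4 := mul_le_mul_of_nonneg_left h1 (by positivity : 0 ≤ 4 * η ^ 2)
    nlinarith [sq_nonneg (η ^ 2 * inner ℝ (A s) s - inner ℝ (A h) h)]
  have herr : inner ℝ s (gradient f x - A h) ≤ H * R * (d * η) := by
    have h1 := norm_gradient_sub_sub_hessian_le (θ := θs) hf hH hH0 (x := θs) (y := x)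
      (by simpa using hR0) hx
    rw [gradient_eq_zero_of_isLocalMin hmin, sub_zero] at h1
    refine (real_inner_le_norm _ _).trans ?_
    rw [hsn]
    calc √(d : ℝ) * ‖gradient f x - A h‖ ≤ √(d : ℝ) * (H * R * (√(d : ℝ) * η)) := by
          gcongr
          exact h1.trans (by gcongr)
      _ = H * R * ((√(d : ℝ) * √(d : ℝ)) * η) := by ring
      _ = _ := by rw [hdd]
  have hsplit : inner ℝ s (gradient f x) = inner ℝ (A s) h + inner ℝ s (gradient f x - A h) := by
    have h1 := hsymm s h
    simp only [ContinuousLinearMap.coe_coe] at h1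
    rw [h1, inner_sub_right]
    ring
  rw [← hσx, hsplit, Finset.sum_add_distrib]
  simp only [Finset.sum_const, Finset.card_univ, Fintype.card_fin, nsmul_eq_mul]
  have h1 : inner ℝ (A h) h / (2 * η) ≤ (f x - f θs) / η + H * R * (d * η) := by
    rw [div_le_iff₀ (by positivity)]
    have e : ((f x - f θs) / η + H * R * (d * η)) * (2 * η) =
        2 * (f x - f θs) + 2 * (H * R * (d * η ^ 2)) := by
      field_simp
    rw [e]
    exact hAh
  have h2 := mul_le_mul_of_nonneg_left hAs (by positivity : 0 ≤ η / 2)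
  linarith

/-- Adagrad in rotated coordinates, with the smoothness constants of the region visited. -/
lemma adagradAverage_comp_apply_le (hV : V ∈ Matrix.orthogonalGroup (Fin d) ℝ)
    (hf : TwiceDifferentiable f) (hH : HessianLipschitz f H) (hH0 : 0 ≤ H)
    (hmin : IsLocalMin f θs) (hD0 : ∀ k, 0 ≤ D k)
    (hD : ∀ x, inner ℝ (hessian f θs x) x ≤ ∑ k, D k * apply V.transpose x k ^ 2)
    (hbdd : BddBelow (Set.range f)) {η τ l : ℝ} (hη : 0 < η) (hτ : 0 < τ) (hl1 : 1 ≤ l)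
    {x₀ : Vec d} {T : ℕ} (hT : 1 ≤ T)
    (hR : ∀ t < T, ‖apply V (adagrad η τ (fun x => f (apply V x)) x₀ t) - θs‖ ≤ R)
    (hl : ∀ n ≤ T, ∀ i, Real.log (1 + (∑ k ∈ Finset.range n,
      gradient (fun x => f (apply V x)) (adagrad η τ (fun x => f (apply V x)) x₀ k) i ^ 2) /
        τ ^ 2) ≤ l) :
    adagradAverage η τ (fun x => f (apply V x)) x₀ T ≤
      (2 * ((f (apply V x₀) - ⨅ θ, f θ) / η) + d * τ +
        3 / 2 * (η * (∑ k, (D k + 4 * (H * R))) * l)) / √(T : ℝ) := by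
  set g : Vec d → ℝ := fun x => f (apply V x) with hg
  set x := adagrad η τ g x₀ with hx
  set Δ := f (apply V x₀) - ⨅ θ, f θ with hΔ
  set S := ∑ k, (D k + 4 * (H * R)) with hS
  have hR0 : 0 ≤ R := (norm_nonneg _).trans (hR 0 hT)
  have hM0 : ∀ k, 0 ≤ D k + 4 * (H * R) := fun k => by
    have := hD0 k
    positivity
  have hS0 : 0 ≤ S := Finset.sum_nonneg fun k _ => hM0 k
  have hΔ0 : 0 ≤ Δ := sub_nonneg.2 (ciInf_le hbdd _)
  have hdrop : ∀ n, g x₀ - g (x n) ≤ Δ := fun n => sub_le_sub_left (ciInf_le hbdd _) _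
  have hη' : 0 ≤ Δ / η := by positivity
  have hdτ : 0 ≤ d * τ := by positivity
  have hηS : 0 ≤ η * S := by positivity
  have hηSl : η * S ≤ η * S * l := le_mul_of_one_le_right hηS hl1
  refine adagradAverage_le_of_sum_le hT ?_
  have h2R : ∀ t < T, ‖apply V (x t) - θs‖ ≤ 2 * R := fun t ht => by linarith [hR t ht]
  -- The bound `R` says nothing about the point after the last averaged iterate. If a step is no
  -- longer than `R`, that point lies within `2 R`, which is why the descent inequality is stated on
  -- the doubled ball.
  rcases le_total (√(d : ℝ) * η) R with hcase | hcase
  · have hR2 : ∀ t ≤ T, ‖apply V (x t) - θs‖ ≤ 2 * R := by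
      intro t ht
      rcases ht.lt_or_eq with h | h
      · exact h2R t h
      · obtain ⟨m, rfl⟩ : ∃ m, T = m + 1 := ⟨T - 1, by omega⟩
        rw [h]
        have h1 := hR m (Nat.lt_succ_self m)
        have h2 : ‖apply V (x (m + 1)) - apply V (x m)‖ ≤ √(d : ℝ) * η := by
          rw [← apply_sub, norm_apply hV]
          exact norm_adagrad_succ_sub_le hη hτ m
        have h3 := norm_add_le (apply V (x (m + 1)) - apply V (x m)) (apply V (x m) - θs)
        rw [sub_add_sub_cancel] at h3
        linarith
    have h := sum_l1norm_adagrad_le hη hτ hM0 (n := T) (x₀ := x₀)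
      (fun k hk => descentAt_comp_apply hV hf hH hH0 hD (hR2 k hk.le) (hR2 (k + 1) hk))
      (hl T le_rfl) (hdrop T)
    refine h.trans (mul_le_mul_of_nonneg_left ?_ (Real.sqrt_nonneg _))
    rw [← hS]
    linarith
  -- Otherwise the regret bound is used only for the first `T - 1` steps, and the last gradient is
  -- bounded directly through its suboptimality. This is one term, affordable because `√T ≥ 1`.
  · obtain ⟨m, rfl⟩ : ∃ m, T = m + 1 := ⟨T - 1, by omega⟩
    have hdesc : ∀ k < m, DescentAt g (fun k => D k + 4 * (H * R)) (x k) (x (k + 1)) :=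
      fun k hk => descentAt_comp_apply hV hf hH hH0 hD (h2R k (by omega)) (h2R (k + 1) (by omega))
    have h := sum_l1norm_adagrad_le hη hτ hM0 hdesc (hl m (by omega)) (hdrop m)
    have hle := adagrad_le_initial hη hτ hM0 hdesc (hl m (by omega))
    have hlast := l1norm_gradient_le hV hf hH hH0 hmin hD hη hcase (hR m (Nat.lt_succ_self m))
    rw [← gradient_comp_apply hf.1] at hlast
    have hinf : ⨅ θ, f θ ≤ f θs := ciInf_le hbdd _
    have h1 : (f (apply V (x m)) - f θs) / η ≤ Δ / η + η / 2 * S * l := by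
      rw [div_le_iff₀ hη]
      have e : (Δ / η + η / 2 * S * l) * η = Δ + η ^ 2 / 2 * S * l := by
        field_simp
      have e1 : g (x m) = f (apply V (x m)) := rfl
      have e2 : g x₀ = f (apply V x₀) := rfl
      rw [e]
      linarith
    rw [Finset.sum_range_succ]
    have hsm : √(m : ℝ) ≤ √((m + 1 : ℕ) : ℝ) := Real.sqrt_le_sqrt (by push_cast; linarith)
    have hs1 : 1 ≤ √((m + 1 : ℕ) : ℝ) :=
      Real.one_le_sqrt.2 (by push_cast; linarith [m.cast_nonneg (α := ℝ)])
    have hB0 : 0 ≤ Δ / η + d * τ + η / 2 * S * l := by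
      have : 0 ≤ η / 2 * S * l := by positivity
      positivity
    have h3 := h.trans (mul_le_mul_of_nonneg_right hsm hB0)
    have h4 : l1norm (gradient g (x m)) ≤ Δ / η + η * S * l := by
      have : l1norm (gradient g (x m)) ≤ η / 2 * S + (f (apply V (x m)) - f θs) / η := hlast
      linarith
    have hC0 : 0 ≤ Δ / η + η * S * l := by linarith
    have h5 := h4.trans (le_mul_of_one_le_left hC0 hs1)
    calc _ ≤ √((m + 1 : ℕ) : ℝ) * (Δ / η + d * τ + η / 2 * S * l) +
          √((m + 1 : ℕ) : ℝ) * (Δ / η + η * S * l) := add_le_add h3 h5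
      _ = _ := by ring

/-- With `B + c` as radius, this bounds the drift added to each diagonal constant. Summed over `d`
coordinates and combined with `μ β d ≤ 8 L_f`, it costs `16 ε L_f`. -/
lemma threshold₁_consequence {lamH c B β δ ε : ℝ} (hH : H ≤ threshold₁ lamH c B β δ ε)
    (hBc : 0 < B + c) (hδ : 0 < δ) (hδβ : δ < β) (hε : 0 ≤ ε) (hl : 0 ≤ lamH) :
    4 * (H * (B + c)) ≤ 2 * (ε * (lamH * β)) := by
  rw [threshold₁, le_div_iff₀ (by positivity)] at hH
  rcases le_total H 0 with h0 | h0
  · have h1 : H * (B + c) ≤ 0 := mul_nonpos_of_nonpos_of_nonneg h0 hBc.le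
    have : 0 ≤ ε * (lamH * β) := by
      have : 0 ≤ β := by linarith
      positivity
    linarith
  · have h1 : 0 ≤ H * (B + c) * δ := by positivity
    have h2 : 0 ≤ ε * lamH * δ := by positivity
    linarith

end Reparam

/-- The argument of the logarithmic factor, as a polynomial in
`T, d, L_f, η, 1/τ, ‖∇f(θ₀)‖_∞`. -/
noncomputable def logPolynomial : MvPolynomial (Fin 6) ℝ :=
  MvPolynomial.C 3 + MvPolynomial.X 0 * (MvPolynomial.X 1 * (MvPolynomial.X 5 +
    MvPolynomial.X 0 * (MvPolynomial.C 3 * MvPolynomial.X 2 * MvPolynomial.X 3)) ^ 2) *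
    MvPolynomial.X 4 ^ 2

lemma eval_logPolynomial (T d Lf η r G : ℝ) :
    MvPolynomial.eval ![T, d, Lf, η, r, G] logPolynomial =
      3 + T * (d * (G + T * (3 * Lf * η)) ^ 2) * r ^ 2 := by
  simp [logPolynomial]

end EGOP

/-! ### The two convergence bounds -/

open EGOP in
theorem mainTheorem1 :
    ∃ (C : ℝ) (p : MvPolynomial (Fin 6) ℝ), 0 < C ∧
    ∀ (d : ℕ) [NeZero d]
      (f : EGOP.Vec d → ℝ) (ρ : Measure (EGOP.Vec d)) [IsProbabilityMeasure ρ]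
      (θstar θ₀ : EGOP.Vec d) (c H : ℝ) (L : Fin d → ℝ)
      (V : Matrix (Fin d) (Fin d) ℝ) (lam : Fin d → ℝ)
      (η τ δ ε : ℝ) (T : ℕ),
      -- the objective
      EGOP.TwiceDifferentiable f →
      IsLocalMin f θstar →
      EGOP.HessianLipschitz f H →
      EGOP.CoordSmooth f L →
      BddBelow (Set.range f) →
      -- the sampling distribution
      EGOP.MeanZeroIsotropic ρ c →
      0 < c → ‖θstar‖ ≤ c →
      Integrable (fun θ => ‖θ - θstar‖ ^ 4) ρ →
      -- the EGOP eigenbasis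
      EGOP.IsEigendecomposition (EGOP.egop ρ f) V lam →
      -- Adagrad parameters and horizon
      0 < η → 0 < τ → 1 ≤ T →
      0 < δ → δ < 1 → 0 < ε → ε < 1 →
      let ftilde : EGOP.Vec d → ℝ := fun x => f (EGOP.apply V x)
      let xtilde₀ : EGOP.Vec d := EGOP.apply V.transpose θ₀
      let β : ℝ := EGOP.density V
      let ζ : ℝ := δ / (1 + δ)
      let lamH : ℝ := EGOP.lambdaMax (EGOP.hessian f θstar)
      let Lf : ℝ := ∑ i, L i
      let Δf : ℝ := f θ₀ - ⨅ θ, f θ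
      let logFactor : ℝ := Real.log (MvPolynomial.eval
        ![(T : ℝ), (d : ℝ), Lf, η, 1 / τ, EGOP.linftyNorm (gradient f θ₀)] p)
      -- smallness of the Lipschitz constant of the Hessian
      ζ ≤ β * ε * √(1 - ε ^ 2) / (β * ε * √(1 - ε ^ 2) + 4 - ε ^ 2) →
      H ≤ min
        (EGOP.threshold₁ lamH c (EGOP.adagradRadius η τ ftilde xtilde₀ T) β δ ε)
        (EGOP.threshold₂ d lamH c (EGOP.centralMoment ρ θstar 3)
          (EGOP.centralMoment ρ θstar 4) δ) →
      -- Adagrad on the reparameterized objective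
      EGOP.adagradAverage η τ ftilde xtilde₀ T ≤
        C * (η / √(T : ℝ) * ((1 / (β - δ) * (EGOP.stableRank lam / d) + ε) * Lf) * logFactor
          + Δf / (η * √(T : ℝ)) + d * τ / √(T : ℝ)) ∧
      -- Adagrad in the original coordinates, for comparison
      EGOP.adagradAverage η τ f θ₀ T ≤
        C * (η / √(T : ℝ) * Lf * logFactor
          + Δf / (η * √(T : ℝ)) + d * τ / √(T : ℝ)) := by
  -- The rotated bound needs `3 / 2 * 56 = 84`, where `56 = 40 + 16` collects the diagonal majorant
  -- and the Hessian drift.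
  refine ⟨100, logPolynomial, by norm_num, ?_⟩
  intro d _ f ρ _ θs θ₀ c H L V lam η τ δ ε T hf hmin hH hL hbdd hρ hc0 hc hint hV hη hτ hT
    hδ _ hε hε1 ftilde xtilde₀ β ζ lamH Lf Δf logFactor hζ hHmin
  obtain ⟨hH1, hH2⟩ := le_min_iff.1 hHmin
  have hO := hV.orthogonal
  have hH0 := hH.nonneg
  have hβ : 0 < β := density_pos hO
  obtain ⟨hδε, hδβ6, hδβ⟩ := zeta_consequences hβ hδ hε hε1 hζ
  have hLf0 : 0 ≤ Lf := Finset.sum_nonneg fun i _ => (hL.1 i).le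
  have hT0 : (0 : ℝ) < T := by exact_mod_cast hT
  have hs0 : 0 < √(T : ℝ) := Real.sqrt_pos.2 hT0
  have hΔ0 : 0 ≤ Δf := sub_nonneg.2 (ciInf_le hbdd _)
  have hlogdef : logFactor = Real.log (3 + T * (d * (linftyNorm (gradient f θ₀) +
      T * (3 * Lf * η)) ^ 2) * (1 / τ) ^ 2) := by
    simp only [logFactor, eval_logPolynomial]
  -- The constant term `3 > e` of the polynomial ensures this; it absorbs the log-free term from the
  -- last iterate.
  have hl1 : 1 ≤ logFactor := by
    rw [hlogdef, Real.le_log_iff_exp_le (by positivity)]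
    have : 0 ≤ T * (d * (linftyNorm (gradient f θ₀) + T * (3 * Lf * η)) ^ 2) * (1 / τ) ^ 2 := by
      positivity
    linarith [Real.exp_one_lt_three]
  have hVx : apply V xtilde₀ = θ₀ := apply_apply_transpose hO θ₀
  have hG := norm_le_sqrt_card_mul_linftyNorm (gradient f θ₀)
  constructor
  · obtain ⟨hLβ, D, hD0, hD, hDsum⟩ := exists_diagonal_majorant hf hL hH hmin hρ hint hc0 hc hV hδ
      hε.le hδε hδβ6 hH2
    set B := adagradRadius η τ ftilde xtilde₀ T with hB
    have hB0 : 0 ≤ B := (norm_nonneg _).trans (norm_adagrad_le_adagradRadius (t := 0) hT)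
    have hl0 : 0 ≤ lamH :=
      lambdaMax_nonneg (hf.isSymmetric_hessian θs) (inner_hessian_nonneg hf hH hH0 hmin)
    have hHR := threshold₁_consequence hH1 (by linarith) hδ hδβ hε.le hl0
    have hgrad : ∀ x, gradient ftilde x = apply V.transpose (gradient f (apply V x)) :=
      gradient_comp_apply hf.1 V
    have hlip : ∀ x y, ‖gradient ftilde y - gradient ftilde x‖ ≤ 3 * Lf * ‖y - x‖ := by
      intro x y
      rw [hgrad, hgrad, ← apply_sub, norm_apply_transpose hO, ← norm_apply hO (y - x), apply_sub]
      exact hL.norm_gradient_sub_le _ _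
    have hG' : ‖gradient ftilde xtilde₀‖ ≤ √(d : ℝ) * linftyNorm (gradient f θ₀) := by
      rw [hgrad, norm_apply_transpose hO, hVx]
      exact hG
    -- Rotation preserves the norm of the iterates, and `‖θs‖ ≤ c`, so the denominator of the first
    -- threshold is the radius around the minimum.
    have hR : ∀ t < T, ‖apply V (adagrad η τ ftilde xtilde₀ t) - θs‖ ≤ B + c := by
      intro t ht
      refine (norm_sub_le _ _).trans (add_le_add ?_ hc)
      rw [norm_apply hO]
      exact norm_adagrad_le_adagradRadius ht
    have h := adagradAverage_comp_apply_le hO hf hH hH0 hmin hD0 hD hbdd hη hτ hl1 hT hR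
      (fun n hn i => (log_accumulator_le hη hτ (by positivity) hlip hG' hn i).trans_eq
        hlogdef.symm)
    refine h.trans ?_
    rw [hVx]
    set E := (1 / (β - δ) * (stableRank lam / d) + ε) * Lf with hE
    have hS : ∑ k, (D k + 4 * (H * (B + c))) ≤ 56 * E := by
      rw [Finset.sum_add_distrib]
      simp only [Finset.sum_const, Finset.card_univ, Fintype.card_fin, nsmul_eq_mul]
      have h1 : d * (4 * (H * (B + c))) ≤ d * (2 * (ε * (lamH * β))) := by gcongr
      have h2 : ε * (lamH * β * d) ≤ ε * (8 * Lf) := by gcongr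
      have h3 : ε * Lf ≤ E := by
        have : 0 ≤ 1 / (β - δ) * (stableRank lam / d) := by
          have := sub_pos.2 hδβ
          have := stableRank_nonneg (lam := lam)
          positivity
        rw [hE, add_mul]
        have := mul_nonneg this hLf0
        linarith
      have h4 : ∑ k, D k ≤ 40 * E := hDsum
      linarith
    have hηl : 0 ≤ η * logFactor := by positivity
    have h5 := mul_le_mul_of_nonneg_left hS hηl
    have hE0 : 0 ≤ η * E * logFactor := by
      have h6 : 0 ≤ ∑ k, (D k + 4 * (H * (B + c))) := Finset.sum_nonneg fun k _ => by
        have := hD0 k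
        positivity
      have h7 : 0 ≤ E := by linarith
      positivity
    have h6 : 0 ≤ Δf / η := by positivity
    have h7 : 0 ≤ d * τ := by positivity
    rw [div_le_iff₀ hs0]
    have e : 100 * (η / √(T : ℝ) * E * logFactor + Δf / (η * √(T : ℝ)) + d * τ / √(T : ℝ)) *
        √(T : ℝ) = 100 * (η * E * logFactor) + 100 * (Δf / η) + 100 * (d * τ) := by
      field_simp
    rw [e]
    have e2 : f θ₀ - ⨅ θ, f θ = Δf := rfl
    rw [e2]
    linarith
  · have hK : 0 ≤ 3 * Lf := by positivity
    have h := adagradAverage_le_of_sum_le hT (sum_l1norm_adagrad_le (x₀ := θ₀) (n := T) hη hτ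
      (fun i => (hL.1 i).le)
      (fun k _ => hL.descentAt _ _)
      (fun i => (log_accumulator_le hη hτ hK (fun x y => hL.norm_gradient_sub_le x y) hG le_rfl
        i).trans_eq hlogdef.symm)
      (D := Δf) (sub_le_sub_left (ciInf_le hbdd _) _))
    refine h.trans ?_
    have h5 : 0 ≤ η * Lf * logFactor := by positivity
    have h6 : 0 ≤ Δf / η := by positivity
    have h7 : 0 ≤ d * τ := by positivity
    rw [div_le_iff₀ hs0]
    have e : 100 * (η / √(T : ℝ) * Lf * logFactor + Δf / (η * √(T : ℝ)) + d * τ / √(T : ℝ)) *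
        √(T : ℝ) = 100 * (η * Lf * logFactor) + 100 * (Δf / η) + 100 * (d * τ) := by
      field_simp
    rw [e]
    have e2 : ∑ i, L i = Lf := rfl
    rw [e2]
    linarith
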